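/- Let $\alpha>0$, $\beta\in(0,1)$ and $k=\tfrac34$ (the TCP Compound parameters), and put $w(x,t)=\bigl(x^{1-k}+\alpha(1-k)t\bigr)^{1/(1-k)}$ for $x,t\ge 0$. *The chain $V_n(p)$.* Let $p\in(0,1)$. If the window size (in packets) just after a loss is the integer $x\ge 0$, then $\lfloor w(x,i)\rfloor$ packets are sent in the $i$-th subsequent round trip, $i=0,1,2,\dots$, as long as no loss occurs. Every packet is lost with probability $p$, independently of all other packets and of the initial window $V_0(p)$. Let $G^p_x$ be the index $i$ of the first round trip in which a packet is lost, so that $\mathbb P(G^p_x>m)=(1-p)^{\sum_{i=0}^m\lfloor w(x,i)\rfloor}$. Let $V_0(p)\ge 0$ be a random variable and let the window sizes at the successive loss epochs be $$V_{n+1}(p)=(1-\beta)\Bigl(V_n(p)^{1-k}+\alpha(1-k)\,G^p_{\lfloor V_n(p)\rfloor}\Bigr)^{1/(1-k)},\qquad n\ge 0,$$ where the losses after different loss epochs are independent. *The limit chain $\overline V_n$.* For $x\ge 0$ let $\overline G_x\ge0$ be a random variable with, for $y\ge 0$, $$\mathbb P(\overline G_x\ge y)=\exp\Bigl(-xy-2\alpha(1-k)x^ky^2-2\alpha^2(1-k)^2x^{2k-1}y^3-\alpha^3(1-k)^3x^{3k-2}y^4-\tfrac{1}{5}\alpha^4(1-k)^4x^{4k-3}y^5\Bigr)$$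 (with $x^{4k-3}=x^0=1$, also for $x=0$). Let $\overline V_0\ge 0$ have an arbitrary distribution and let $$\overline V_{n+1}=(1-\beta)\Bigl(\overline V_n^{\,1-k}+\alpha(1-k)\,\overline G_{\overline V_n}\Bigr)^{1/(1-k)},\qquad n\ge 0,$$ where, given $\overline V_0,\dots,\overline V_n$, the variable $\overline G_{\overline V_n}$ has the law of $\overline G_x$ with $x=\overline V_n$. *Claim.* If $p^{1/(2-k)}V_0(p)$ converges in distribution to $\overline V_0$ as $p\to0$, then the Markov chain $\{p^{1/(2-k)}V_n(p)\}_{n\ge0}$ converges in distribution to the Markov chain $\{\overline V_n\}_{n\ge0}$ as $p\to 0$, in the sense of finite-dimensional distributions: for every finite set $I\subset\{0,1,2,\dots\}$ the random vector $(p^{1/(2-k)}V_n(p))_{n\in I}$ converges in distribution to $(\overline V_n)_{n\in I}$. -/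

import Mathlib

open MeasureTheory ProbabilityTheory Filter Topology

/-- Window size reached after `t` loss-free round trip times from the window size `x`:
`(x ^ (1 - k) + α (1 - k) t) ^ (1 / (1 - k))`. -/
noncomputable def windowAfter (α k x t : ℝ) : ℝ :=
  (x ^ (1 - k) + α * (1 - k) * t) ^ (1 / (1 - k))

/-- Number of packets sent in the round trip with index `i` (starting at `i = 0`) of a loss-free
period whose integer initial window size is `x`. -/
noncomputable def packetsInRound (α k : ℝ) (x i : ℕ) : ℕ :=
  ⌊windowAfter α k x i⌋₊

/-- The time of the first packet loss, in round trip times, from the integer initial window size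
`x`: the index of the first round trip in which a packet is lost. Here `lost i j` says whether the
packet in position `j` of the round trip `i` is lost; only the positions
`j < packetsInRound α k x i` are used. (The value is `0` if there is never a loss, an event of
probability zero.) -/
noncomputable def firstLossTime (α k : ℝ) (x : ℕ) (lost : ℕ → ℕ → Bool) : ℕ :=
  sInf {i | ∃ j < packetsInRound α k x i, lost i j = true}

/-- The window size just after a loss which occurs `g` round trip times after the previous one,
if the window size just after the previous loss was `v`. -/
noncomputable def windowAfterLoss (α β k v g : ℝ) : ℝ :=
  (1 - β) * windowAfter α k v g

/-- The window sizes `V 0, V 1, …` just after the successive losses, started from `V 0 = v`: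
`V (n + 1) = (1 - β) (V n ^ (1 - k) + α (1 - k) G) ^ (1 / (1 - k))`, where `G` is the time of the
first loss from the integer initial window size `⌊V n⌋`, computed from the
packet losses `lost n` of the `n`-th loss-free period. -/
noncomputable def lossEpochWindow (α β k : ℝ) (lost : ℕ → ℕ → ℕ → Bool) (v : ℝ) : ℕ → ℝ
  | 0 => v
  | n + 1 => windowAfterLoss α β k (lossEpochWindow α β k lost v n)
      (firstLossTime α k ⌊lossEpochWindow α β k lost v n⌋₊ (lost n))

/-- Random initial window `V0 ≥ 0` and random packet losses: each packet is lost with probability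
`p`, independently of the other packets and of the initial window.
`lost n i j` is the loss indicator of the packet in position `j` of the round trip `i`
after the `n`-th loss. -/
structure IsPacketLossModel {Ω : Type*} [MeasurableSpace Ω] (P : Measure Ω) (p : ℝ)
    (V0 : Ω → ℝ) (lost : ℕ → ℕ → ℕ → Ω → Bool) : Prop where
  measurable_init : Measurable V0
  nonneg_init : ∀ᵐ ω ∂P, 0 ≤ V0 ω
  measurable_lost : ∀ n i j, Measurable (lost n i j)
  prob_lost : ∀ n i j, P {ω | lost n i j ω = true} = ENNReal.ofReal p
  iIndepFun_lost : iIndepFun (fun (q : ℕ × ℕ × ℕ) => lost q.1 q.2.1 q.2.2) P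
  indepFun_init : IndepFun V0 (fun ω (q : ℕ × ℕ × ℕ) => lost q.1 q.2.1 q.2.2 ω) P

/-- The complementary distribution function `y ↦ ℙ(G ≥ y)`, `y ≥ 0`, of the limiting (scaled) time
between losses from the (scaled) window size `x`. -/
noncomputable def limitGapTail (α k x y : ℝ) : ℝ :=
  Real.exp (-(x * y) - 2 * α * (1 - k) * x ^ k * y ^ 2
    - 2 * α ^ 2 * (1 - k) ^ 2 * x ^ (2 * k - 1) * y ^ 3
    - α ^ 3 * (1 - k) ^ 3 * x ^ (3 * k - 2) * y ^ 4
    - α ^ 4 * (1 - k) ^ 4 * x ^ (4 * k - 3) * y ^ 5 / 5)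

/-- `V` is the limit Markov chain, with times between losses `G`: given `V 0, …, V n`, the variable
`G n` has the complementary distribution function `limitGapTail α k (V n)`, so that it depends on
the past through `V n` only, and `V (n + 1)` is computed from `V n` and `G n`. -/
structure IsLimitChain {Ω : Type*} [MeasurableSpace Ω] (P : Measure Ω) (α β k : ℝ)
    (V G : ℕ → Ω → ℝ) : Prop where
  measurable_init : Measurable (V 0)
  nonneg_init : ∀ᵐ ω ∂P, 0 ≤ V 0 ω
  measurable_gap : ∀ n, Measurable (G n)
  succ : ∀ n ω, V (n + 1) ω = windowAfterLoss α β k (V n ω) (G n ω)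
  condTail_gap : ∀ n, ∀ y : ℝ, 0 ≤ y →
    P⟦{ω | y ≤ G n ω} | ⨆ m : Fin (n + 1), MeasurableSpace.comap (V m) inferInstance⟧
      =ᵐ[P] fun ω => limitGapTail α k (V n ω) y

/-! A loss takes about `1 / p` packets, which fits windows of order `p ^ (-4/5)` and gaps of order
`p ^ (-1/5)` round trips. In both chains a gap can be generated from one standard exponential
variable `e`. Since `N` packets survive with probability `exp (-c N)`, `c = -log (1 - p)`, the first
lossy round has the law of the first round at which `c` times the packet count exceeds `e`
(`map_firstLossTime`). The limit gap is the time `t` at which the integral of `(r + a s) ^ 4` over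
`[0, t]` equals `e`, where `r = x ^ (1/4)` and `a = α / 4` (`limitGapTail_three_quarters`,
`expMeasure_setOf_le_limitGap`).

With the same `e` on both sides the convergence of one step is deterministic: the scaled packet
count is a Riemann sum of that integral, so the scaled gap converges for every `e`, even along
initial windows that vary with `p` (`tendsto_mul_roundExceeding`, `tendsto_scaled_windowAfterLoss`).

Such continuous convergence of the driven maps carries convergence in distribution through one step
(`TendstoInDistribution.of_map_prod`). Induction is run on the whole path frozen at time `n` rather
than on the current window, which yields joint convergence. -/

/-! ### Weak convergence under continuously converging maps. -/

/-- Integrals of uniformly bounded functions `f i` which converge continuously, against weakly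
convergent probability measures, converge. -/
theorem tendsto_integral_of_tendsto_prod_nhds {ι E : Type*} [TopologicalSpace E]
    [MeasurableSpace E] [OpensMeasurableSpace E] [HasOuterApproxClosed E]
    {l : Filter ι} [l.IsCountablyGenerated]
    {μ : ι → ProbabilityMeasure E} {μ' : ProbabilityMeasure E} (hμ : Tendsto μ l (𝓝 μ'))
    {f : ι → E → ℝ} {f' : E → ℝ} {M : ℝ} (hf : ∀ i, Measurable (f i))
    (hM : ∀ i x, |f i x| ≤ M)
    (hlim : ∀ x, Tendsto (fun q : ι × E => f q.1 q.2) (l ×ˢ 𝓝 x) (𝓝 (f' x))) :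
    Tendsto (fun i => ∫ x, f i x ∂(μ i : Measure E)) l (𝓝 (∫ x, f' x ∂(μ' : Measure E))) := by
  rcases l.eq_or_neBot with rfl | hne
  · exact tendsto_bot
  have hpt : ∀ x, Tendsto (fun i => f i x) l (𝓝 (f' x)) := fun x =>
    (hlim x).comp (tendsto_id.prodMk tendsto_const_pure |>.mono_right
      (Filter.prod_mono le_rfl (pure_le_nhds x)))
  have hloc : ∀ x, ∀ ε > 0, ∃ S ∈ l, ∃ U ∈ 𝓝 x, ∀ i ∈ S, ∀ y ∈ U, |f i y - f' x| ≤ ε := by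
    intro x ε hε
    have := (hlim x) (Metric.closedBall_mem_nhds (f' x) hε)
    obtain ⟨S, hS, U, hU, h⟩ := Filter.mem_prod_iff.1 this
    exact ⟨S, hS, U, hU, fun i hi y hy => by simpa [Real.dist_eq] using h (Set.mk_mem_prod hi hy)⟩
  have hnear : ∀ x, ∀ ε > 0, ∃ U ∈ 𝓝 x, ∀ y ∈ U, |f' y - f' x| ≤ ε := by
    intro x ε hε
    obtain ⟨S, hS, U, hU, h⟩ := hloc x ε hε
    refine ⟨U, hU, fun y hy => ?_⟩
    exact le_of_tendsto ((hpt y).sub_const (f' x)).abs (mem_of_superset hS fun i hi => h i hi y hy)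
  have hcont : Continuous f' := by
    refine continuous_iff_continuousAt.2 fun x => Metric.tendsto_nhds.2 fun ε hε => ?_
    obtain ⟨U, hU, h⟩ := hnear x (ε / 2) (by positivity)
    filter_upwards [hU] with y hy
    rw [Real.dist_eq]
    linarith [h y hy]
  have hM' : ∀ x, |f' x| ≤ M := fun x => le_of_tendsto (hpt x).abs (Eventually.of_forall (hM · x))
  have hM0 : 0 ≤ M := by
    obtain ⟨i⟩ := hne.nonempty
    obtain ⟨x⟩ := (μ i).nonempty
    exact (abs_nonneg _).trans (hM i x)
  have hint' : ∀ ν : ProbabilityMeasure E, Integrable f' (ν : Measure E) := fun ν =>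
    Integrable.of_bound hcont.measurable.aestronglyMeasurable M (Eventually.of_forall hM')
  have hint : ∀ i, ∀ ν : ProbabilityMeasure E, Integrable (f i) (ν : Measure E) := fun i ν =>
    Integrable.of_bound (hf i).aestronglyMeasurable M (Eventually.of_forall (hM i))
  have h1 : Tendsto (fun i => ∫ x, f' x ∂(μ i : Measure E)) l (𝓝 (∫ x, f' x ∂(μ' : Measure E))) :=
    ProbabilityMeasure.tendsto_iff_forall_integral_tendsto.1 hμ
      (BoundedContinuousFunction.ofNormedAddCommGroup f' hcont M hM')
  suffices h2 : Tendsto (fun i => ∫ x, f i x ∂(μ i : Measure E) - ∫ x, f' x ∂(μ i : Measure E)) l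
      (𝓝 0) by simpa using h2.add h1
  obtain ⟨S, hS⟩ := l.exists_antitone_basis
  rw [Metric.tendsto_nhds]
  intro ε hε
  -- With this `δ` the contributions `δ` and `2 M δ` of the final bound add up to `ε / 2`.
  set δ := ε / (2 * (1 + 2 * M)) with hδ
  have hδ0 : 0 < δ := by positivity
  -- The portmanteau theorem controls closed sets, hence the closure. Continuous convergence at `x`
  -- keeps a neighbourhood of `x` out of the bad sets for large `m`, so the `F m` decrease to the
  -- empty set and one of them has small limit mass.
  let F : ℕ → Set E := fun m => closure {x | ∃ i ∈ S m, δ < |f i x - f' x|}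
  have hFc : ∀ m, IsClosed (F m) := fun m => isClosed_closure
  have hFanti : Antitone F := fun m n hmn =>
    closure_mono fun x ⟨i, hi, h⟩ => ⟨i, hS.antitone hmn hi, h⟩
  have hFempty : ⋂ m, F m = ∅ := by
    refine Set.eq_empty_of_forall_notMem fun x hx => ?_
    obtain ⟨T, hT, U, hU, h⟩ := hloc x (δ / 2) (by positivity)
    obtain ⟨U', hU', h'⟩ := hnear x (δ / 2) (by positivity)
    obtain ⟨m, -, hm⟩ := hS.1.mem_iff.1 hT
    obtain ⟨y, ⟨hy, hy'⟩, i, hi, hyi⟩ :=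
      mem_closure_iff_nhds.1 (Set.mem_iInter.1 hx m) _ (inter_mem hU hU')
    have h1 := h i (hm hi) y hy
    have h2 := h' y hy'
    rw [abs_sub_comm] at h2
    linarith [abs_sub_le (f i y) (f' x) (f' y)]
  have hFlim : Tendsto (fun m => (μ' : Measure E) (F m)) atTop (𝓝 0) := by
    have := tendsto_measure_iInter_atTop (μ := (μ' : Measure E))
      (fun m => (hFc m).measurableSet.nullMeasurableSet) hFanti ⟨0, measure_ne_top _ _⟩
    rwa [hFempty, measure_empty] at this
  obtain ⟨m, hm⟩ := (hFlim.eventually_lt_const (ENNReal.ofReal_pos.2 hδ0)).exists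
  have hlimsup := ProbabilityMeasure.limsup_measure_closed_le_of_tendsto hμ (hFc m)
  have hev := eventually_lt_of_limsup_lt (hlimsup.trans_lt hm)
  filter_upwards [hev, hS.1.mem_of_mem (i := m) trivial] with i hi hiS
  have hreal : (μ i : Measure E).real (F m) ≤ δ := by
    rw [Measure.real]
    exact ENNReal.toReal_le_of_le_ofReal hδ0.le hi.le
  have hbound : ∀ x, |f i x - f' x| ≤ δ + (F m).indicator (fun _ => 2 * M) x := by
    intro x
    by_cases hx : x ∈ F m
    · rw [Set.indicator_of_mem hx]
      have := abs_sub (f i x) (f' x)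
      linarith [hM i x, hM' x]
    · rw [Set.indicator_of_notMem hx, add_zero]
      by_contra! hlt
      exact hx (subset_closure ⟨i, hiS, hlt⟩)
  rw [dist_zero_right, ← integral_sub (hint i _) (hint' _)]
  have hind : Integrable ((F m).indicator (fun _ => 2 * M)) (μ i : Measure E) :=
    (integrable_const _).indicator (hFc m).measurableSet
  calc ‖∫ x, (f i x - f' x) ∂(μ i : Measure E)‖
      ≤ ∫ x, ‖f i x - f' x‖ ∂(μ i : Measure E) := norm_integral_le_integral_norm _
    _ ≤ ∫ x, (δ + (F m).indicator (fun _ => 2 * M) x) ∂(μ i : Measure E) :=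
        integral_mono ((hint i _).sub (hint' _)).norm ((integrable_const _).add hind) hbound
    _ = δ + (μ i : Measure E).real (F m) * (2 * M) := by
        rw [integral_add (integrable_const _) hind, integral_indicator_const _ (hFc m).measurableSet]
        simp
    _ ≤ δ + δ * (2 * M) := by gcongr
    _ = ε / 2 := by rw [hδ]; field_simp
    _ < ε := by linarith

/-- One step of a randomly driven recursion preserves convergence in distribution, if the driven
maps converge continuously for almost every value of the driving noise. -/
theorem MeasureTheory.TendstoInDistribution.of_map_prod {ι E F : Type*} [TopologicalSpace E]
    [MeasurableSpace E] [OpensMeasurableSpace E] [HasOuterApproxClosed E] [FirstCountableTopology E]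
    [TopologicalSpace F] [MeasurableSpace F] [BorelSpace F]
    {A : Type*} [MeasurableSpace A] (ν : Measure A) [IsProbabilityMeasure ν]
    {l : Filter ι} [l.IsCountablyGenerated]
    {Ω : ι → Type*} [∀ i, MeasurableSpace (Ω i)] {P : ∀ i, Measure (Ω i)}
    [∀ i, IsProbabilityMeasure (P i)] {Ω' : Type*} [MeasurableSpace Ω'] {P' : Measure Ω'}
    [IsProbabilityMeasure P'] {X : ∀ i, Ω i → E} {X' : Ω' → E} {Y : ∀ i, Ω i → F} {Y' : Ω' → F}
    (hX : TendstoInDistribution X l X' P P')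
    (hYm : ∀ i, AEMeasurable (Y i) (P i)) (hYm' : AEMeasurable Y' P')
    {φ : ι → E × A → F} {φ' : E × A → F} (hφm : ∀ i, Measurable (φ i)) (hφm' : Measurable φ')
    (hY : ∀ i, (P i).map (Y i) = (((P i).map (X i)).prod ν).map (φ i))
    (hY' : P'.map Y' = ((P'.map X').prod ν).map φ')
    (hφ : ∀ x, ∀ᵐ e ∂ν, Tendsto (fun q : ι × E => φ q.1 (q.2, e)) (l ×ˢ 𝓝 x) (𝓝 (φ' (x, e)))) :
    TendstoInDistribution Y l Y' P P' where
  forall_aemeasurable := hYm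
  aemeasurable_limit := hYm'
  tendsto := by
    refine ProbabilityMeasure.tendsto_iff_forall_integral_tendsto.2 fun f => ?_
    have key : ∀ (μ : Measure E) [IsProbabilityMeasure μ] (ψ : E × A → F), Measurable ψ →
        ∫ y, f y ∂((μ.prod ν).map ψ) = ∫ x, ∫ e, f (ψ (x, e)) ∂ν ∂μ := by
      intro μ _ ψ hψ
      rw [integral_map hψ.aemeasurable f.continuous.measurable.aestronglyMeasurable,
        integral_prod]
      exact Integrable.of_bound (f.continuous.measurable.comp hψ).aestronglyMeasurable ‖f‖
        (Eventually.of_forall fun _ => f.norm_coe_le_norm _)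
    simp only [ProbabilityMeasure.coe_mk, hY, hY']
    have hpX : ∀ i, IsProbabilityMeasure ((P i).map (X i)) := fun i =>
      Measure.isProbabilityMeasure_map (hX.forall_aemeasurable i)
    have hpX' : IsProbabilityMeasure (P'.map X') :=
      Measure.isProbabilityMeasure_map hX.aemeasurable_limit
    -- Once the noise is integrated out, dominated convergence shows that the functions of `x` that
    -- remain converge continuously.
    rw [key _ _ hφm']
    simp_rw [fun i => key ((P i).map (X i)) (φ i) (hφm i)]
    refine tendsto_integral_of_tendsto_prod_nhds (M := ‖f‖) hX.tendsto (fun i => ?_) (fun i x => ?_)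
      fun x => ?_
    · exact (StronglyMeasurable.integral_prod_right'
        (f.continuous.measurable.comp (hφm i)).stronglyMeasurable).measurable
    · have := norm_integral_le_of_norm_le_const (μ := ν) (f := fun e => f (φ i (x, e))) (C := ‖f‖)
        (Eventually.of_forall fun _ => f.norm_coe_le_norm _)
      simpa using this
    · refine tendsto_integral_filter_of_dominated_convergence (fun _ => ‖f‖) ?_ ?_
        (integrable_const _) ?_
      · exact Eventually.of_forall fun q => (f.continuous.measurable.comp
          ((hφm q.1).comp measurable_prodMk_left)).aestronglyMeasurable
      · exact Eventually.of_forall fun q => Eventually.of_forall fun _ => f.norm_coe_le_norm _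
      · filter_upwards [hφ x] with e he
        exact (f.continuous.tendsto _).comp he

/-- By Fubini only the law of each section matters. This replaces the packet losses by an
exponential variable without changing the joint law with the past. -/
theorem map_prod_eq_map_prod_of_forall_map_eq {E A B D : Type*} [MeasurableSpace E]
    [MeasurableSpace A] [MeasurableSpace B] [MeasurableSpace D] (μ : Measure E)
    (ν₁ : Measure A) (ν₂ : Measure B) [SFinite ν₁] [SFinite ν₂] {f : E × A → D} {g : E × B → D}
    (hf : Measurable f) (hg : Measurable g)
    (h : ∀ x, ν₁.map (fun a => f (x, a)) = ν₂.map (fun b => g (x, b))) :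
    (μ.prod ν₁).map (fun q => (q.1, f q)) = (μ.prod ν₂).map (fun q => (q.1, g q)) := by
  ext s hs
  have hf' : Measurable fun q : E × A => (q.1, f q) := measurable_fst.prodMk hf
  have hg' : Measurable fun q : E × B => (q.1, g q) := measurable_fst.prodMk hg
  rw [Measure.map_apply hf' hs, Measure.map_apply hg' hs, Measure.prod_apply (hf' hs),
    Measure.prod_apply (hg' hs)]
  refine lintegral_congr fun x => ?_
  have := congrArg (fun m : Measure D => m (Prod.mk x ⁻¹' s)) (h x)
  have hfx : Measurable fun a => f (x, a) := hf.comp measurable_prodMk_left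
  have hgx : Measurable fun b => g (x, b) := hg.comp measurable_prodMk_left
  rwa [Measure.map_apply hfx (measurable_prodMk_left hs),
    Measure.map_apply hgx (measurable_prodMk_left hs)] at this

theorem Nat.le_sInf_setOf_iff {q : ℕ → Prop} (h : ∃ i, q i) (m : ℕ) :
    m ≤ sInf {i | q i} ↔ ∀ j < m, ¬ q j := by
  constructor
  · intro hm j hj hq
    exact absurd (hm.trans (Nat.sInf_le hq)) (not_le.2 hj)
  · intro hm
    by_contra! hlt
    exact hm _ hlt (Nat.sInf_mem h)

/-! ### Exponential noise. -/

instance : IsProbabilityMeasure (expMeasure 1) := isProbabilityMeasure_expMeasure one_pos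

/-- Truncating at `0` makes the noise nonnegative everywhere instead of almost surely; the case `s =
0` is then the whole space. -/
theorem expMeasure_one_setOf_le_max {s : ℝ} (hs : 0 ≤ s) :
    expMeasure 1 {e | s ≤ max e 0} = ENNReal.ofReal (Real.exp (-s)) := by
  rcases hs.eq_or_lt with rfl | hs
  · simp
  have hset : {e : ℝ | s ≤ max e 0} = Set.Ici s := by
    ext e
    simp [hs]
  have hatom : expMeasure 1 {s} = 0 :=
    withDensity_absolutelyContinuous _ _ (measure_singleton s)
  have hIio : Set.Ici s = {s} ∪ Set.Ioi s := by
    rw [Set.union_comm, Set.Ioi_union_left]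
  have hreal : (expMeasure 1).real (Set.Ioi s) = Real.exp (-s) := by
    have h1 := cdf_expMeasure_eq one_pos s
    rw [cdf_eq_real, if_pos hs.le, one_mul] at h1
    rw [← Set.compl_Iic, probReal_compl_eq_one_sub measurableSet_Iic, h1]
    ring
  have hIoi : expMeasure 1 (Set.Ioi s) = ENNReal.ofReal (Real.exp (-s)) := by
    rw [← hreal, Measure.real, ENNReal.ofReal_toReal (measure_ne_top _ _)]
  rw [hset, ← hIoi]
  refine le_antisymm ?_ (measure_mono Set.Ioi_subset_Ici_self)
  rw [hIio]
  refine (measure_union_le _ _).trans ?_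
  rw [hatom, zero_add]

/-! ### Packet counts as Riemann sums. -/

theorem windowAfter_three_quarters (α x t : ℝ) :
    windowAfter α (3 / 4) x t = (x ^ (1 / 4 : ℝ) + α / 4 * t) ^ 4 := by
  rw [windowAfter, show (1 : ℝ) - 3 / 4 = 1 / 4 by norm_num,
    show (1 : ℝ) / (1 / 4) = (4 : ℕ) by norm_num, Real.rpow_natCast]
  ring

theorem windowAfter_three_quarters_nonneg (α x t : ℝ) : 0 ≤ windowAfter α (3 / 4) x t := by
  rw [windowAfter_three_quarters]
  positivity

/-- The number of packets sent in the first `m` round trips from the window size `x`. -/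
noncomputable def packetsBefore (α : ℝ) (x m : ℕ) : ℕ :=
  ∑ i ∈ Finset.range m, packetsInRound α (3 / 4) x i

theorem packetsBefore_mono (α : ℝ) (x : ℕ) : Monotone (packetsBefore α x) := fun _ _ h =>
  Finset.sum_le_sum_of_subset (Finset.range_subset_range.2 h)

/-- The integral of `(r + a s) ^ 4` over `0 ≤ s ≤ t`. -/
noncomputable def windowIntegral (a r t : ℝ) : ℝ := ((r + a * t) ^ 5 - r ^ 5) / (5 * a)

/-- Together with `le_five_mul_pow_four`, this compares the integral of a fourth power over one step
with its left and right endpoint values. -/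
theorem five_mul_pow_four_le {u h : ℝ} (hu : 0 ≤ u) (hh : 0 ≤ h) :
    5 * h * u ^ 4 ≤ (u + h) ^ 5 - u ^ 5 := by
  have : (u + h) ^ 5 - u ^ 5 - 5 * h * u ^ 4
      = 10 * u ^ 3 * h ^ 2 + 10 * u ^ 2 * h ^ 3 + 5 * u * h ^ 4 + h ^ 5 := by ring
  have : 0 ≤ 10 * u ^ 3 * h ^ 2 + 10 * u ^ 2 * h ^ 3 + 5 * u * h ^ 4 + h ^ 5 := by positivity
  linarith

theorem le_five_mul_pow_four {u h : ℝ} (hu : 0 ≤ u) (hh : 0 ≤ h) :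
    (u + h) ^ 5 - u ^ 5 ≤ 5 * h * (u + h) ^ 4 := by
  have : 5 * h * (u + h) ^ 4 - ((u + h) ^ 5 - u ^ 5)
      = 10 * u ^ 3 * h ^ 2 + 20 * u ^ 2 * h ^ 3 + 15 * u * h ^ 4 + 4 * h ^ 5 := by ring
  have : 0 ≤ 10 * u ^ 3 * h ^ 2 + 20 * u ^ 2 * h ^ 3 + 15 * u * h ^ 4 + 4 * h ^ 5 := by positivity
  linarith

/-- The window grows during a round, so its floored value at the start of the round is below the
integral over the round. -/
theorem packetsBefore_le {α b : ℝ} (hα : 0 < α) (hb : 0 < b) (x m : ℕ) :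
    b ^ 5 * packetsBefore α x m ≤
      windowIntegral (α / 4) (b * (x : ℝ) ^ (1 / 4 : ℝ)) (b * m) := by
  set ρ := b * (x : ℝ) ^ (1 / 4 : ℝ) with hρ
  have hρ0 : 0 ≤ ρ := by positivity
  induction m with
  | zero => simp [packetsBefore, windowIntegral]
  | succ m ih =>
    rw [packetsBefore, Finset.sum_range_succ, ← packetsBefore]
    have h1 : (packetsInRound α (3 / 4) x m : ℝ) ≤ ((x : ℝ) ^ (1 / 4 : ℝ) + α / 4 * m) ^ 4 := by
      rw [← windowAfter_three_quarters]
      exact Nat.floor_le (windowAfter_three_quarters_nonneg _ _ _)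
    have h2 : b ^ 5 * (packetsInRound α (3 / 4) x m : ℝ) ≤ b * (ρ + α / 4 * (b * m)) ^ 4 := by
      calc _ ≤ b ^ 5 * ((x : ℝ) ^ (1 / 4 : ℝ) + α / 4 * m) ^ 4 := by gcongr
        _ = _ := by rw [hρ]; ring
    have h3 := five_mul_pow_four_le (u := ρ + α / 4 * (b * m)) (h := α / 4 * b)
      (by positivity) (by positivity)
    have h4 : windowIntegral (α / 4) ρ (b * (m + 1 : ℕ)) - windowIntegral (α / 4) ρ (b * m)
        = ((ρ + α / 4 * (b * m) + α / 4 * b) ^ 5 - (ρ + α / 4 * (b * m)) ^ 5)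
          / (5 * (α / 4)) := by
      rw [windowIntegral, windowIntegral]
      push_cast
      ring
    have h5 : b * (ρ + α / 4 * (b * m)) ^ 4 ≤
        ((ρ + α / 4 * (b * m) + α / 4 * b) ^ 5 - (ρ + α / 4 * (b * m)) ^ 5)
          / (5 * (α / 4)) := by
      rw [le_div_iff₀ (by positivity)]
      linarith
    push_cast at h4 ⊢
    linarith

/-- The integral over a round is at most its right endpoint value. Passing to the left endpoint
costs increments of the fourth power, which telescope; each floor loses at most one packet, whence
`b * m * b ^ 4`. -/
theorem le_packetsBefore {α b : ℝ} (hα : 0 < α) (hb : 0 < b) (x m : ℕ) :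
    windowIntegral (α / 4) (b * (x : ℝ) ^ (1 / 4 : ℝ)) (b * m)
      - b * ((b * (x : ℝ) ^ (1 / 4 : ℝ) + α / 4 * (b * m)) ^ 4 - (b * (x : ℝ) ^ (1 / 4 : ℝ)) ^ 4)
      - b * m * b ^ 4 ≤ b ^ 5 * packetsBefore α x m := by
  set ρ := b * (x : ℝ) ^ (1 / 4 : ℝ) with hρ
  have hρ0 : 0 ≤ ρ := by positivity
  induction m with
  | zero => simp [packetsBefore, windowIntegral]
  | succ m ih =>
    rw [packetsBefore, Finset.sum_range_succ, ← packetsBefore]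
    have h1 : ((x : ℝ) ^ (1 / 4 : ℝ) + α / 4 * m) ^ 4 - 1 ≤ packetsInRound α (3 / 4) x m := by
      rw [← windowAfter_three_quarters]
      exact (Nat.sub_one_lt_floor _).le
    have h2 : b * (ρ + α / 4 * (b * m)) ^ 4 - b ^ 5 ≤
        b ^ 5 * (packetsInRound α (3 / 4) x m : ℝ) := by
      calc _ = b ^ 5 * (((x : ℝ) ^ (1 / 4 : ℝ) + α / 4 * m) ^ 4 - 1) := by rw [hρ]; ring
        _ ≤ _ := by gcongr
    have h3 := le_five_mul_pow_four (u := ρ + α / 4 * (b * m)) (h := α / 4 * b)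
      (by positivity) (by positivity)
    have h4 : windowIntegral (α / 4) ρ (b * (m + 1 : ℕ)) - windowIntegral (α / 4) ρ (b * m)
        = ((ρ + α / 4 * (b * m) + α / 4 * b) ^ 5 - (ρ + α / 4 * (b * m)) ^ 5)
          / (5 * (α / 4)) := by
      rw [windowIntegral, windowIntegral]
      push_cast
      ring
    have h5 : ((ρ + α / 4 * (b * m) + α / 4 * b) ^ 5 - (ρ + α / 4 * (b * m)) ^ 5)
          / (5 * (α / 4)) ≤ b * (ρ + α / 4 * (b * m) + α / 4 * b) ^ 4 := by
      rw [div_le_iff₀ (by positivity)]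
      linarith
    have h6 : ρ + α / 4 * (b * (m + 1)) = ρ + α / 4 * (b * m) + α / 4 * b := by ring
    push_cast at h4 ⊢
    rw [h6]
    nlinarith

theorem tendsto_pow_five_mul_packetsBefore {ι : Type*} {l : Filter ι} {α : ℝ} (hα : 0 < α)
    {b : ι → ℝ} (hb : ∀ i, 0 < b i) (hb0 : Tendsto b l (𝓝 0)) {x m : ι → ℕ} {r t : ℝ}
    (hx : Tendsto (fun i => b i * (x i : ℝ) ^ (1 / 4 : ℝ)) l (𝓝 r))
    (hm : Tendsto (fun i => b i * m i) l (𝓝 t)) :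
    Tendsto (fun i => b i ^ 5 * packetsBefore α (x i) (m i)) l
      (𝓝 (windowIntegral (α / 4) r t)) := by
  have h1 : Tendsto (fun i => windowIntegral (α / 4) (b i * (x i : ℝ) ^ (1 / 4 : ℝ)) (b i * m i)) l
      (𝓝 (windowIntegral (α / 4) r t)) :=
    (((hx.add (hm.const_mul _)).pow 5).sub (hx.pow 5)).div_const _
  have h2 := (h1.sub (hb0.mul (((hx.add (hm.const_mul (α / 4))).pow 4).sub (hx.pow 4)))).sub
    (hm.mul (hb0.pow 4))
  refine tendsto_of_tendsto_of_tendsto_of_le_of_le ?_ h1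
    (fun i => le_packetsBefore hα (hb i) (x i) (m i)) fun i => packetsBefore_le hα (hb i) (x i) (m i)
  simpa using h2

/-- From round `4 / α` on the window is at least `1`, even for `x = 0`, so every round sends a
packet. -/
theorem exists_le_packetsBefore {α : ℝ} (hα : 0 < α) (x : ℕ) (N : ℕ) :
    ∃ m, N ≤ packetsBefore α x m := by
  obtain ⟨m, hm⟩ := exists_nat_ge (4 / α)
  have hp : ∀ i, m ≤ i → 1 ≤ packetsInRound α (3 / 4) x i := by
    intro i hi
    rw [packetsInRound, Nat.one_le_floor_iff, windowAfter_three_quarters]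
    refine one_le_pow₀ ?_
    have h1 : (m : ℝ) ≤ i := by exact_mod_cast hi
    have h2 : α / 4 * (4 / α) ≤ α / 4 * i := by gcongr; linarith
    have h3 : α / 4 * (4 / α) = 1 := by field_simp
    have h4 : (0 : ℝ) ≤ (x : ℝ) ^ (1 / 4 : ℝ) := by positivity
    linarith
  refine ⟨m + N, ?_⟩
  induction N with
  | zero => simp
  | succ N ih =>
    have := hp (m + N) (by lia)
    rw [packetsBefore, ← add_assoc, Finset.sum_range_succ, ← packetsBefore]
    lia

/-- The round trip in which the number of sent packets, weighted by `c`, exceeds `max e 0`. -/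
noncomputable def roundExceeding (α c : ℝ) (x : ℕ) (e : ℝ) : ℕ :=
  sInf {i | max e 0 < c * packetsBefore α x (i + 1)}

/-- The packet count is monotone, so only the last index below `m` matters, and the shift `i + 1`
turns it into the count before `m`. For `m = 0` the bound holds for every `e` thanks to the
truncation. -/
theorem le_roundExceeding_iff {α c : ℝ} (hα : 0 < α) (hc : 0 < c) (x m : ℕ) (e : ℝ) :
    m ≤ roundExceeding α c x e ↔ c * packetsBefore α x m ≤ max e 0 := by
  rw [roundExceeding, Nat.le_sInf_setOf_iff]
  · constructor
    · intro h
      cases m with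
      | zero => simp [packetsBefore]
      | succ m => exact not_lt.1 (h m (Nat.lt_succ_self m))
    · intro h j hj
      refine not_lt.2 (le_trans ?_ h)
      gcongr
      exact packetsBefore_mono α x hj
  · obtain ⟨N, hN⟩ := exists_nat_gt (max e 0 / c)
    obtain ⟨m, hm⟩ := exists_le_packetsBefore hα x N
    refine ⟨m, ?_⟩
    rw [div_lt_iff₀ hc] at hN
    calc max e 0 < N * c := hN
      _ = c * N := mul_comm _ _
      _ ≤ _ := by
        gcongr
        exact hm.trans (packetsBefore_mono α x (Nat.le_succ m))

theorem measurable_roundExceeding {α c : ℝ} (hα : 0 < α) (hc : 0 < c) (x : ℕ) :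
    Measurable (roundExceeding α c x) := by
  refine Monotone.measurable fun e e' h => ?_
  rw [le_roundExceeding_iff hα hc]
  exact ((le_roundExceeding_iff hα hc _ _ _).1 le_rfl).trans (max_le_max_right 0 h)

/-- The time `t ≥ 0` for which `windowIntegral a r t = max e 0`. -/
noncomputable def limitGap (a r e : ℝ) : ℝ :=
  ((r ^ 5 + 5 * a * max e 0) ^ (1 / 5 : ℝ) - r) / a

theorem le_limitGap_iff {a r t : ℝ} (ha : 0 < a) (hr : 0 ≤ r) (ht : 0 ≤ t) (e : ℝ) :
    t ≤ limitGap a r e ↔ windowIntegral a r t ≤ max e 0 := by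
  have hA : 0 ≤ r ^ 5 + 5 * a * max e 0 := by positivity
  rw [limitGap, windowIntegral, le_div_iff₀ ha, div_le_iff₀ (by positivity), one_div,
    le_sub_iff_add_le, Real.le_rpow_inv_iff_of_pos (by positivity) hA (by norm_num),
    show (5 : ℝ) = (5 : ℕ) by norm_num, Real.rpow_natCast, sub_le_iff_le_add]
  push_cast
  rw [show t * a + r = r + a * t by ring, show r ^ 5 + 5 * a * max e 0 = max e 0 * (5 * a) + r ^ 5 by ring]

theorem limitGap_nonneg {a r : ℝ} (ha : 0 < a) (hr : 0 ≤ r) (e : ℝ) : 0 ≤ limitGap a r e := by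
  rw [le_limitGap_iff ha hr le_rfl]
  simp [windowIntegral]

theorem windowIntegral_lt {a r s t : ℝ} (ha : 0 < a) (hr : 0 ≤ r) (hs : 0 ≤ s) (hst : s < t) :
    windowIntegral a r s < windowIntegral a r t := by
  unfold windowIntegral
  gcongr

/-- Both gaps are inverse functions of an accumulated mass. Convergence of the mass at fixed times,
with strict growth of the limit mass, gives convergence of the inverses. -/
theorem tendsto_mul_roundExceeding {ι : Type*} {l : Filter ι} {α : ℝ} (hα : 0 < α)
    {b c : ι → ℝ} (hb : ∀ i, 0 < b i) (hb0 : Tendsto b l (𝓝 0)) (hc : ∀ i, 0 < c i)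
    (hcb : Tendsto (fun i => c i / b i ^ 5) l (𝓝 1)) {x : ι → ℕ} {r : ℝ} (hr : 0 ≤ r)
    (hx : Tendsto (fun i => b i * (x i : ℝ) ^ (1 / 4 : ℝ)) l (𝓝 r)) (e : ℝ) :
    Tendsto (fun i => b i * roundExceeding α (c i) (x i) e) l (𝓝 (limitGap (α / 4) r e)) := by
  have ha : 0 < α / 4 := by positivity
  have hceil : ∀ t, 0 ≤ t → Tendsto (fun i => b i * ⌈t / b i⌉₊) l (𝓝 t) := by
    intro t ht
    refine tendsto_of_tendsto_of_tendsto_of_le_of_le (g := fun _ => t) (h := fun i => t + b i)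
      tendsto_const_nhds (by simpa using hb0.const_add t) (fun i => ?_) fun i => ?_
    · have := mul_le_mul_of_nonneg_left (Nat.le_ceil (t / b i)) (hb i).le
      rwa [mul_div_cancel₀ _ (hb i).ne'] at this
    · have := mul_le_mul_of_nonneg_left (Nat.ceil_lt_add_one (div_nonneg ht (hb i).le)).le (hb i).le
      rwa [mul_add, mul_div_cancel₀ _ (hb i).ne', mul_one] at this
  have hsum : ∀ t, 0 ≤ t → Tendsto (fun i => c i * packetsBefore α (x i) ⌈t / b i⌉₊) l
      (𝓝 (windowIntegral (α / 4) r t)) := by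
    intro t ht
    have := hcb.mul (tendsto_pow_five_mul_packetsBefore hα hb hb0 hx (hceil t ht))
    rw [one_mul] at this
    refine this.congr fun i => ?_
    have := (hb i).ne'
    field_simp
  refine tendsto_order.2 ⟨fun t ht => ?_, fun t ht => ?_⟩
  · rcases lt_or_ge t 0 with h0 | h0
    · exact Eventually.of_forall fun i => h0.trans_le (mul_nonneg (hb i).le (Nat.cast_nonneg _))
    obtain ⟨s, hts, hs⟩ := exists_between ht
    -- A second intermediate point makes the inequality at `s` strict, so that it survives for the
    -- approximating masses.
    obtain ⟨s', hss', hs'⟩ := exists_between hs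
    have hs0 : 0 ≤ s := h0.trans hts.le
    have hlt : windowIntegral (α / 4) r s < max e 0 :=
      (windowIntegral_lt ha hr hs0 hss').trans_le
        ((le_limitGap_iff ha hr (hs0.trans hss'.le) e).1 hs'.le)
    filter_upwards [(hsum s hs0).eventually_lt_const hlt] with i hi
    have h1 := (le_roundExceeding_iff hα (hc i) _ _ _).2 hi.le
    have h2 : s / b i ≤ roundExceeding α (c i) (x i) e :=
      (Nat.le_ceil _).trans (by exact_mod_cast h1)
    rw [div_le_iff₀ (hb i)] at h2
    linarith
  · obtain ⟨s, hs, hst⟩ := exists_between ht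
    have hs0 : 0 ≤ s := (limitGap_nonneg ha hr e).trans hs.le
    have hlt : max e 0 < windowIntegral (α / 4) r s := by
      rw [← not_le, ← le_limitGap_iff ha hr hs0, not_le]
      exact hs
    filter_upwards [(hsum s hs0).eventually_const_lt hlt, (hceil s hs0).eventually_lt_const hst]
      with i hi hi'
    have h1 : roundExceeding α (c i) (x i) e < ⌈s / b i⌉₊ := by
      rw [← not_le, le_roundExceeding_iff hα (hc i), not_le]
      exact hi
    refine lt_of_le_of_lt ?_ hi'
    have : (roundExceeding α (c i) (x i) e : ℝ) ≤ ⌈s / b i⌉₊ := by exact_mod_cast h1.le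
    exact mul_le_mul_of_nonneg_left this (hb i).le

/-! ### Independence, measurability and frozen paths. -/

theorem ProbabilityTheory.IndepFun.prodMk_left_of_prodMk_right {Ω A B C : Type*}
    [MeasurableSpace Ω] [MeasurableSpace A] [MeasurableSpace B] [MeasurableSpace C]
    {P : Measure Ω} [IsProbabilityMeasure P] {f : Ω → A} {g : Ω → B} {h : Ω → C}
    (hf : Measurable f) (hg : Measurable g) (hh : Measurable h)
    (hfgh : IndepFun f (fun ω => (g ω, h ω)) P) (hgh : IndepFun g h P) :
    IndepFun (fun ω => (f ω, g ω)) h P := by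
  have := Measure.isProbabilityMeasure_map (μ := P) hf.aemeasurable
  have := Measure.isProbabilityMeasure_map (μ := P) hg.aemeasurable
  have := Measure.isProbabilityMeasure_map (μ := P) hh.aemeasurable
  have h1 := (indepFun_iff_map_prod_eq_prod_map_map hf.aemeasurable
    (hg.prodMk hh).aemeasurable).1 hfgh
  have h2 := (indepFun_iff_map_prod_eq_prod_map_map hg.aemeasurable hh.aemeasurable).1 hgh
  have hfg : IndepFun f g P := hfgh.comp (φ := id) (ψ := Prod.fst) measurable_id measurable_fst
  have h3 := (indepFun_iff_map_prod_eq_prod_map_map hf.aemeasurable hg.aemeasurable).1 hfg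
  refine (indepFun_iff_map_prod_eq_prod_map_map (hf.prodMk hg).aemeasurable hh.aemeasurable).2 ?_
  refine Measure.ext_prod₃' fun {s t u} hs ht hu => ?_
  have e1 : P.map (fun ω => ((f ω, g ω), h ω)) ((s ×ˢ t) ×ˢ u)
      = P.map (fun ω => (f ω, (g ω, h ω))) (s ×ˢ (t ×ˢ u)) := by
    rw [Measure.map_apply ((hf.prodMk hg).prodMk hh) ((hs.prod ht).prod hu),
      Measure.map_apply (hf.prodMk (hg.prodMk hh)) (hs.prod (ht.prod hu))]
    congr 1
    ext ω
    simp [and_assoc]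
  rw [e1, h1, h2, h3]
  simp only [Measure.prod_prod, mul_assoc]

theorem measurable_of_forall_apply_apply {Ω : Type*} {mΩ : MeasurableSpace Ω}
    {f : Ω → ℕ → ℕ → Bool} (h : ∀ i j, Measurable fun ω => f ω i j) : Measurable f :=
  measurable_pi_iff.2 fun i => measurable_pi_iff.2 (h i)

theorem measurable_firstLossTime (α k : ℝ) (x : ℕ) : Measurable (firstLossTime α k x) := by
  have hset : ∀ i, MeasurableSet
      {ℓ : ℕ → ℕ → Bool | ∃ j < packetsInRound α k x i, ℓ i j = true} := by
    intro i
    have : {ℓ : ℕ → ℕ → Bool | ∃ j < packetsInRound α k x i, ℓ i j = true}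
        = ⋃ j, ⋃ (_ : j < packetsInRound α k x i), {ℓ | ℓ i j = true} := by
      ext ℓ
      simp
    rw [this]
    refine MeasurableSet.iUnion fun j => MeasurableSet.iUnion fun _ => ?_
    have hij : Measurable fun ℓ : ℕ → ℕ → Bool => ℓ i j := by fun_prop
    exact hij (measurableSet_singleton true)
  refine measurable_of_Ici fun m => ?_
  cases m with
  | zero => simp
  | succ m =>
    -- The union removes the loss patterns without any loss, where `sInf ∅ = 0`.
    have : firstLossTime α k x ⁻¹' Set.Ici (m + 1)
        = (⋃ i, {ℓ | ∃ j < packetsInRound α k x i, ℓ i j = true}) ∩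
          ⋂ i, ⋂ (_ : i < m + 1), {ℓ | ∃ j < packetsInRound α k x i, ℓ i j = true}ᶜ := by
      ext ℓ
      by_cases hex : ∃ i, ∃ j < packetsInRound α k x i, ℓ i j = true
      · have := Nat.le_sInf_setOf_iff hex (m + 1)
        simp only [Set.mem_preimage, Set.mem_Ici, firstLossTime, this, Set.mem_inter_iff,
          Set.mem_iUnion, Set.mem_ofPred_eq, Set.mem_iInter, Set.mem_compl_iff, hex, true_and]
      · have h0 : firstLossTime α k x ℓ = 0 := by
          exact (congrArg sInf (Set.eq_empty_of_forall_notMem fun i hi => hex ⟨i, hi⟩)).trans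
            Nat.sInf_empty
        simp only [Set.mem_preimage, Set.mem_Ici, h0, Set.mem_inter_iff, Set.mem_iUnion,
          Set.mem_ofPred_eq, hex, false_and, iff_false]
        lia
    rw [this]
    exact (MeasurableSet.iUnion hset).inter
      (MeasurableSet.iInter fun i => MeasurableSet.iInter fun _ => (hset i).compl)

theorem Measurable.firstLossTime {E : Type*} [MeasurableSpace E] {N : E → ℕ}
    {ℓ : E → ℕ → ℕ → Bool} (hN : Measurable N) (hℓ : Measurable ℓ) (α k : ℝ) :
    Measurable fun ω => firstLossTime α k (N ω) (ℓ ω) := by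
  have h : Measurable fun q : ℕ × (ℕ → ℕ → Bool) => _root_.firstLossTime α k q.1 q.2 := by
    refine measurable_from_prod_countable_right fun x => ?_
    exact measurable_firstLossTime α k x
  have h' := h.comp (hN.prodMk hℓ)
  exact h'

theorem Measurable.roundExceeding {E : Type*} [MeasurableSpace E] {N : E → ℕ}
    {e : E → ℝ} (hN : Measurable N) (he : Measurable e) {α c : ℝ} (hα : 0 < α) (hc : 0 < c) :
    Measurable fun ω => roundExceeding α c (N ω) (e ω) := by
  have h : Measurable fun q : ℕ × ℝ => _root_.roundExceeding α c q.1 q.2 :=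
    measurable_from_prod_countable_right fun x => measurable_roundExceeding hα hc x
  exact h.comp (hN.prodMk he)

theorem Measurable.windowAfterLoss {E : Type*} [MeasurableSpace E] {v g : E → ℝ}
    (hv : Measurable v) (hg : Measurable g) (α β k : ℝ) :
    Measurable fun ω => windowAfterLoss α β k (v ω) (g ω) := by
  unfold _root_.windowAfterLoss windowAfter
  fun_prop

theorem measurable_lossEpochWindow (α β k : ℝ) (n : ℕ) :
    Measurable fun q : (ℕ → ℕ → ℕ → Bool) × ℝ => lossEpochWindow α β k q.1 q.2 n := by
  induction n with
  | zero => exact measurable_snd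
  | succ n ih =>
    have hn : Measurable fun q : (ℕ → ℕ → ℕ → Bool) × ℝ => q.1 n :=
      (measurable_pi_apply n).comp measurable_fst
    have hG := Measurable.firstLossTime ih.nat_floor hn α k
    have hG' := (measurable_from_top (f := fun g : ℕ => (g : ℝ))).comp hG
    simp only [lossEpochWindow]
    exact Measurable.windowAfterLoss ih hG' α β k

theorem lossEpochWindow_congr (α β k v : ℝ) {ℓ ℓ' : ℕ → ℕ → ℕ → Bool} {n : ℕ}
    (h : ∀ m < n, ℓ m = ℓ' m) :
    lossEpochWindow α β k ℓ v n = lossEpochWindow α β k ℓ' v n := by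
  induction n with
  | zero => rfl
  | succ n ih =>
    rw [lossEpochWindow, lossEpochWindow, ih fun m hm => h m (hm.trans n.lt_succ_self),
      h n n.lt_succ_self]

/-- The sequence `V` frozen at time `n`. -/
def stoppedPath (V : ℕ → ℝ) (n : ℕ) : ℕ → ℝ := fun m => V (min m n)

/-- The sequence which agrees with `x` up to time `n` and is equal to `v` afterwards. -/
def extendPath (n : ℕ) (x : ℕ → ℝ) (v : ℝ) : ℕ → ℝ := fun m => if m ≤ n then x m else v

/-- Frozen paths live in the same space `ℕ → ℝ` for every `n`, so extending the history is one step
of a recursion there. -/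
theorem stoppedPath_succ (V : ℕ → ℝ) (n : ℕ) :
    stoppedPath V (n + 1) = extendPath n (stoppedPath V n) (V (n + 1)) := by
  ext m
  rcases le_or_gt m n with h | h
  · simp [stoppedPath, extendPath, h, h.trans n.le_succ]
  · simp [stoppedPath, extendPath, h.not_ge, Nat.succ_le_of_lt h]

theorem stoppedPath_self (V : ℕ → ℝ) (n : ℕ) : stoppedPath V n n = V n := by
  simp [stoppedPath]

theorem continuous_extendPath (n : ℕ) :
    Continuous fun q : (ℕ → ℝ) × ℝ => extendPath n q.1 q.2 := by
  refine continuous_pi fun m => ?_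
  unfold extendPath
  split_ifs <;> fun_prop

theorem measurable_stoppedPath {Ω : Type*} [MeasurableSpace Ω] {V : Ω → ℕ → ℝ}
    (hV : ∀ n, Measurable fun ω => V ω n) (n : ℕ) : Measurable fun ω => stoppedPath (V ω) n :=
  measurable_pi_iff.2 fun _ => hV _

/-! ### Laws in the packet loss model. -/

namespace IsPacketLossModel

variable {Ω : Type*} [MeasurableSpace Ω] {P : Measure Ω} {p : ℝ}
  {V0 : Ω → ℝ} {lost : ℕ → ℕ → ℕ → Ω → Bool}

theorem measurable_epoch (hV : IsPacketLossModel P p V0 lost) (n : ℕ) :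
    Measurable fun ω i j => lost n i j ω :=
  measurable_pi_iff.2 fun i => measurable_pi_iff.2 fun j => hV.measurable_lost n i j

theorem measurable_window (hV : IsPacketLossModel P p V0 lost) (α β k : ℝ) (n : ℕ) :
    Measurable fun ω => lossEpochWindow α β k (fun m i j => lost m i j ω) (V0 ω) n :=
  (measurable_lossEpochWindow α β k n).comp
    ((measurable_pi_iff.2 hV.measurable_epoch).prodMk hV.measurable_init)

variable [IsProbabilityMeasure P]

theorem prob_not_lost (hV : IsPacketLossModel P p V0 lost) (hp0 : 0 ≤ p) (n i j : ℕ) :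
    P (lost n i j ⁻¹' {false}) = ENNReal.ofReal (1 - p) := by
  have h1 : lost n i j ⁻¹' {false} = {ω | lost n i j ω = true}ᶜ := by
    ext ω
    simp
  have h2 : MeasurableSet {ω | lost n i j ω = true} :=
    hV.measurable_lost n i j (measurableSet_singleton true)
  rw [h1, prob_compl_eq_one_sub h2, hV.prob_lost, ENNReal.ofReal_sub _ hp0, ENNReal.ofReal_one]

theorem prob_no_loss_before (hV : IsPacketLossModel P p V0 lost) (hp0 : 0 ≤ p) (α : ℝ)
    (n x m : ℕ) :
    P {ω | ∀ i < m, ¬ ∃ j < packetsInRound α (3 / 4) x i, lost n i j ω = true}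
      = ENNReal.ofReal (1 - p) ^ packetsBefore α x m := by
  -- The packets of the first `m` rounds; their number is `packetsBefore α x m`.
  let F : Finset (Σ _ : ℕ, ℕ) :=
    (Finset.range m).sigma fun i => Finset.range (packetsInRound α (3 / 4) x i)
  have hind : iIndepFun (fun s : Σ _ : ℕ, ℕ => lost n s.1 s.2) P :=
    hV.iIndepFun_lost.precomp (g := fun s : Σ _ : ℕ, ℕ => (n, s.1, s.2)) (by
      rintro ⟨a, b⟩ ⟨a', b'⟩ h
      simp only [Prod.mk.injEq, true_and] at h
      simp [h.1, h.2])
  have hset : {ω | ∀ i < m, ¬ ∃ j < packetsInRound α (3 / 4) x i, lost n i j ω = true}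
      = ⋂ s ∈ F, lost n s.1 s.2 ⁻¹' {false} := by
    ext ω
    simp only [not_exists, not_and, Bool.not_eq_true, Set.mem_ofPred_eq, Finset.mem_sigma,
      Finset.mem_range, Set.mem_iInter, Set.mem_preimage, Set.mem_singleton_iff, Sigma.forall,
      and_imp, F]
    exact forall_congr' fun i => ⟨fun h b hi => h hi b, fun h hi b => h b hi⟩
  rw [hset, hind.measure_inter_preimage_eq_mul F (sets := fun _ => {false})
    (fun _ _ => measurableSet_singleton _)]
  simp [hV.prob_not_lost hp0, F, packetsBefore]

/-- Never losing a packet has probability at most `(1 - p) ^ N` for every `N`. -/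
theorem ae_exists_loss (hV : IsPacketLossModel P p V0 lost) (hp0 : 0 < p) {α : ℝ}
    (hα : 0 < α) (n x : ℕ) :
    ∀ᵐ ω ∂P, ∃ i, ∃ j < packetsInRound α (3 / 4) x i, lost n i j ω = true := by
  have hlt : ENNReal.ofReal (1 - p) < 1 := by
    rw [← ENNReal.ofReal_one]
    exact (ENNReal.ofReal_lt_ofReal_iff one_pos).2 (by linarith)
  refine le_antisymm (ge_of_tendsto (ENNReal.tendsto_pow_atTop_nhds_zero_of_lt_one hlt) ?_) zero_le
  refine Eventually.of_forall fun N => ?_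
  obtain ⟨m, hm⟩ := exists_le_packetsBefore hα x N
  calc _ ≤ P {ω | ∀ i < m, ¬ ∃ j < packetsInRound α (3 / 4) x i, lost n i j ω = true} :=
        measure_mono fun ω (hω : ¬ ∃ i, _) i _ h => hω ⟨i, h⟩
    _ = ENNReal.ofReal (1 - p) ^ packetsBefore α x m := hV.prob_no_loss_before hp0.le α n x m
    _ ≤ _ := pow_le_pow_right_of_le_one' hlt.le hm

/-- The time of the first loss has the same law as the first round trip in which the number of
sent packets exceeds an exponential variable of rate `-log (1 - p)`. -/
theorem map_firstLossTime (hV : IsPacketLossModel P p V0 lost) (hp0 : 0 < p) (hp1 : p < 1)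
    {α : ℝ} (hα : 0 < α) (n x : ℕ) :
    P.map (fun ω => firstLossTime α (3 / 4) x (fun i j => lost n i j ω))
      = (expMeasure 1).map (roundExceeding α (-Real.log (1 - p)) x) := by
  have hc : 0 < -Real.log (1 - p) := neg_pos.2 (Real.log_neg (by linarith) (by linarith))
  have hG : Measurable fun ω => firstLossTime α (3 / 4) x (fun i j => lost n i j ω) :=
    (measurable_firstLossTime _ _ _).comp (hV.measurable_epoch n)
  have := Measure.isProbabilityMeasure_map (μ := P) hG.aemeasurable
  refine Measure.ext_of_Ici _ _ fun m => ?_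
  rw [Measure.map_apply hG measurableSet_Ici,
    Measure.map_apply (measurable_roundExceeding hα hc x) measurableSet_Ici]
  have h1 : (fun ω => firstLossTime α (3 / 4) x (fun i j => lost n i j ω)) ⁻¹' Set.Ici m
      =ᵐ[P] {ω | ∀ i < m, ¬ ∃ j < packetsInRound α (3 / 4) x i, lost n i j ω = true} := by
    filter_upwards [hV.ae_exists_loss hp0 hα n x] with ω hω
    exact propext (Nat.le_sInf_setOf_iff hω m)
  have h2 : roundExceeding α (-Real.log (1 - p)) x ⁻¹' Set.Ici m
      = {e | -Real.log (1 - p) * packetsBefore α x m ≤ max e 0} := by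
    ext e
    exact le_roundExceeding_iff hα hc x m e
  rw [measure_congr h1, h2, expMeasure_one_setOf_le_max (by positivity),
    hV.prob_no_loss_before hp0.le, ← ENNReal.ofReal_pow (by linarith)]
  congr 1
  rw [neg_mul, neg_neg, mul_comm, Real.exp_nat_mul, Real.exp_log (by linarith)]

/-- Losses before epoch `n` and those of epoch `n` have disjoint index sets, and the initial window
is independent of all losses together. Padding with `false` is harmless, since the windows up to
time `n` use earlier epochs only. -/
theorem indepFun_window_epoch (hV : IsPacketLossModel P p V0 lost) (n : ℕ) :
    IndepFun (fun ω => (V0 ω, fun m i j => if m < n then lost m i j ω else false))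
      (fun ω i j => lost n i j ω) P := by
  have hpast : Measurable fun ω m i j => if m < n then lost m i j ω else false := by
    refine measurable_pi_iff.2 fun m => measurable_pi_iff.2 fun i => measurable_pi_iff.2 fun j => ?_
    split_ifs
    · exact hV.measurable_lost m i j
    · exact measurable_const
  refine IndepFun.prodMk_left_of_prodMk_right hV.measurable_init hpast (hV.measurable_epoch n) ?_ ?_
  · let ψ : (ℕ × ℕ × ℕ → Bool) → (ℕ → ℕ → ℕ → Bool) × (ℕ → ℕ → Bool) := fun ℓ =>
      (fun m i j => if m < n then ℓ (m, i, j) else false, fun i j => ℓ (n, i, j))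
    have hψ : Measurable ψ := by
      refine Measurable.prodMk ?_ ?_
      · refine measurable_pi_iff.2 fun m => measurable_pi_iff.2 fun i =>
          measurable_pi_iff.2 fun j => ?_
        split_ifs
        · exact measurable_pi_apply _
        · exact measurable_const
      · exact measurable_pi_iff.2 fun i => measurable_pi_iff.2 fun j => measurable_pi_apply _
    exact hV.indepFun_init.comp measurable_id hψ
  · let mq : ℕ × ℕ × ℕ → MeasurableSpace Ω := fun q =>
      MeasurableSpace.comap (lost q.1 q.2.1 q.2.2) inferInstance
    have hdisj : Disjoint {q : ℕ × ℕ × ℕ | q.1 < n} {q : ℕ × ℕ × ℕ | q.1 = n} :=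
      Set.disjoint_left.2 fun q h1 h2 => (ne_of_lt h1) h2
    have hI := indep_iSup_of_disjoint (m := mq)
      (fun q => (hV.measurable_lost q.1 q.2.1 q.2.2).comap_le)
      hV.iIndepFun_lost.iIndep hdisj
    rw [IndepFun_iff_Indep]
    refine indep_of_indep_of_le_left (indep_of_indep_of_le_right hI ?_) ?_
    · refine Measurable.comap_le ?_
      refine measurable_of_forall_apply_apply fun i j => ?_
      refine measurable_iff_comap_le.2 ?_
      exact le_iSup₂_of_le (f := fun q (_ : q ∈ {q : ℕ × ℕ × ℕ | q.1 = n}) => mq q) (n, i, j)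
        rfl le_rfl
    · refine Measurable.comap_le ?_
      refine @measurable_pi_lambda _ _ _ (_) _ _ fun m =>
        measurable_of_forall_apply_apply fun i j => ?_
      by_cases hm : m < n
      · simp only [hm, if_true]
        refine measurable_iff_comap_le.2 ?_
        exact le_iSup₂_of_le (f := fun q (_ : q ∈ {q : ℕ × ℕ × ℕ | q.1 < n}) => mq q) (m, i, j)
          hm le_rfl
      · simp only [hm, if_false]
        exact @measurable_const _ _ _ (_) _

theorem indepFun_stoppedPath_epoch (hV : IsPacketLossModel P p V0 lost) (α β k c : ℝ) (n : ℕ) :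
    IndepFun (fun ω => stoppedPath
        (fun m => c * lossEpochWindow α β k (fun m i j => lost m i j ω) (V0 ω) m) n)
      (fun ω i j => lost n i j ω) P := by
  have hφ : Measurable fun q : ℝ × (ℕ → ℕ → ℕ → Bool) =>
      stoppedPath (fun m => c * lossEpochWindow α β k q.2 q.1 m) n :=
    measurable_stoppedPath (fun m =>
      ((measurable_lossEpochWindow α β k m).comp measurable_swap).const_mul c) n
  have h := (hV.indepFun_window_epoch n).comp hφ measurable_id
  refine h.congr (Eventually.of_forall fun ω => ?_) EventuallyEq.rfl
  ext m
  simp only [Function.comp_apply, stoppedPath]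
  congr 1
  refine lossEpochWindow_congr _ _ _ _ fun q hq => ?_
  rw [lt_min_iff] at hq
  simp [hq.2]

/-- The joint law of the scaled windows up to the `n`-th loss and the time to the next loss. -/
theorem map_stoppedPath_firstLossTime (hV : IsPacketLossModel P p V0 lost) (hp0 : 0 < p)
    (hp1 : p < 1) {α : ℝ} (hα : 0 < α) (β c : ℝ) (n : ℕ) :
    let X : Ω → ℕ → ℝ := fun ω => stoppedPath
      (fun m => c * lossEpochWindow α β (3 / 4) (fun m i j => lost m i j ω) (V0 ω) m) n
    P.map (fun ω => (X ω, firstLossTime α (3 / 4) ⌊X ω n / c⌋₊ (fun i j => lost n i j ω)))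
      = ((P.map X).prod (expMeasure 1)).map
        (fun q => (q.1, roundExceeding α (-Real.log (1 - p)) ⌊q.1 n / c⌋₊ q.2)) := by
  intro X
  have hc : 0 < -Real.log (1 - p) := neg_pos.2 (Real.log_neg (by linarith) (by linarith))
  have hX : Measurable X := measurable_stoppedPath
    (fun m => (hV.measurable_window α β (3 / 4) m).const_mul c) n
  have hL := hV.measurable_epoch n
  have hXL := (indepFun_iff_map_prod_eq_prod_map_map hX.aemeasurable hL.aemeasurable).1
    (hV.indepFun_stoppedPath_epoch α β (3 / 4) c n)
  have hdiv : Measurable fun x : ℕ → ℝ => x n / c := by fun_prop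
  have hfloor : Measurable fun x : ℕ → ℝ => ⌊x n / c⌋₊ := hdiv.nat_floor
  have hf : Measurable fun q : (ℕ → ℝ) × (ℕ → ℕ → Bool) =>
      firstLossTime α (3 / 4) ⌊q.1 n / c⌋₊ q.2 :=
    Measurable.firstLossTime (hfloor.comp measurable_fst) measurable_snd α _
  have hg : Measurable fun q : (ℕ → ℝ) × ℝ =>
      roundExceeding α (-Real.log (1 - p)) ⌊q.1 n / c⌋₊ q.2 :=
    Measurable.roundExceeding (hfloor.comp measurable_fst) measurable_snd hα hc
  have := Measure.isProbabilityMeasure_map (μ := P) hL.aemeasurable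
  have hsection : ∀ x : ℕ → ℝ,
      (P.map fun ω i j => lost n i j ω).map (fun ℓ => firstLossTime α (3 / 4) ⌊x n / c⌋₊ ℓ)
        = (expMeasure 1).map (fun e => roundExceeding α (-Real.log (1 - p)) ⌊x n / c⌋₊ e) := by
    intro x
    rw [Measure.map_map (measurable_firstLossTime _ _ _) hL, Function.comp_def]
    exact hV.map_firstLossTime hp0 hp1 hα n ⌊x n / c⌋₊
  have h := map_prod_eq_map_prod_of_forall_map_eq (P.map X) (P.map fun ω i j => lost n i j ω)
    (expMeasure 1) hf hg hsection
  rw [← h, ← hXL, Measure.map_map (measurable_fst.prodMk hf) (hX.prodMk hL), Function.comp_def]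

end IsPacketLossModel

/-! ### Laws in the limit chain. -/

theorem MeasureTheory.Measure.ext_prod_of_Ici {E : Type*} [MeasurableSpace E]
    {μ ν : Measure (E × ℝ)} [IsFiniteMeasure μ]
    (h : ∀ s, MeasurableSet s → ∀ y, μ (s ×ˢ Set.Ici y) = ν (s ×ˢ Set.Ici y)) : μ = ν := by
  refine Measure.ext_prod fun {s t} hs ht => ?_
  have key : ∀ (m : Measure (E × ℝ)) (t : Set ℝ), MeasurableSet t →
      (m.restrict (s ×ˢ Set.univ)).map Prod.snd t = m (s ×ˢ t) := by
    intro m t ht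
    rw [Measure.map_apply measurable_snd ht, Measure.restrict_apply (measurable_snd ht)]
    congr 1
    ext q
    simp [and_comm]
  have heq : (μ.restrict (s ×ˢ Set.univ)).map Prod.snd
      = (ν.restrict (s ×ˢ Set.univ)).map Prod.snd :=
    Measure.ext_of_Ici _ _ fun y => by
      rw [key μ _ measurableSet_Ici, key ν _ measurableSet_Ici, h s hs y]
  rw [← key μ t ht, ← key ν t ht, heq]

/-- In `r = x ^ (1/4)` the exponent is the binomial expansion of the integral of `(r + α s / 4) ^
4`. -/
theorem limitGapTail_three_quarters {α x : ℝ} (hα : 0 < α) (hx : 0 ≤ x) (y : ℝ) :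
    limitGapTail α (3 / 4) x y
      = Real.exp (-windowIntegral (α / 4) (x ^ (1 / 4 : ℝ)) y) := by
  have hpow : ∀ j : ℕ, (x ^ (1 / 4 : ℝ)) ^ j = x ^ ((j : ℝ) / 4) := by
    intro j
    rw [← Real.rpow_natCast, ← Real.rpow_mul hx]
    congr 1
    ring
  have h4 : x = (x ^ (1 / 4 : ℝ)) ^ 4 := by rw [hpow]; norm_num
  have h3 : x ^ (3 / 4 : ℝ) = (x ^ (1 / 4 : ℝ)) ^ 3 := by rw [hpow]; norm_num
  have h2 : x ^ (2 * (3 / 4) - 1 : ℝ) = (x ^ (1 / 4 : ℝ)) ^ 2 := by rw [hpow]; norm_num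
  have h1 : x ^ (3 * (3 / 4) - 2 : ℝ) = x ^ (1 / 4 : ℝ) := by norm_num
  have h0 : x ^ (4 * (3 / 4) - 3 : ℝ) = 1 := by norm_num
  rw [limitGapTail, h3, h2, h1, h0, windowIntegral]
  set r := x ^ (1 / 4 : ℝ)
  rw [h4]
  congr 1
  field_simp
  ring

theorem Measurable.limitGap {E : Type*} [MeasurableSpace E] {r e : E → ℝ}
    (hr : Measurable r) (he : Measurable e) (a : ℝ) :
    Measurable fun ω => limitGap a (r ω) (e ω) := by
  unfold _root_.limitGap
  fun_prop

theorem expMeasure_setOf_le_limitGap {a r : ℝ} (ha : 0 < a) (hr : 0 ≤ r) (y : ℝ) :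
    expMeasure 1 {e | y ≤ limitGap a r e}
      = ENNReal.ofReal (Real.exp (-windowIntegral a r (max y 0))) := by
  have h0 : 0 ≤ windowIntegral a r (max y 0) := by
    have h1 : 0 ≤ a * max y 0 := by positivity
    have h2 : r ^ 5 ≤ (r + a * max y 0) ^ 5 := by gcongr; linarith
    exact div_nonneg (by linarith) (by positivity)
  rw [← expMeasure_one_setOf_le_max h0]
  congr 1
  ext e
  have := le_limitGap_iff ha hr (le_max_right y 0) e
  simp only [Set.mem_ofPred_eq, ← this, max_le_iff, limitGap_nonneg ha hr e, and_true]

namespace IsLimitChain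

variable {Ω : Type*} [MeasurableSpace Ω] {P : Measure Ω} {α β k : ℝ} {V G : ℕ → Ω → ℝ}

theorem measurable (hV : IsLimitChain P α β k V G) (n : ℕ) : Measurable (V n) := by
  induction n with
  | zero => exact hV.measurable_init
  | succ n ih =>
    have := Measurable.windowAfterLoss ih (hV.measurable_gap n) α β k
    rwa [← funext (hV.succ n)] at this

theorem ae_nonneg (hV : IsLimitChain P α β (3 / 4) V G) (hβ : β < 1) (n : ℕ) :
    ∀ᵐ ω ∂P, 0 ≤ V n ω := by
  cases n with
  | zero => exact hV.nonneg_init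
  | succ n =>
    refine Eventually.of_forall fun ω => ?_
    rw [hV.succ]
    exact mul_nonneg (by linarith) (windowAfter_three_quarters_nonneg _ _ _)

variable [IsProbabilityMeasure P]

/-- The frozen path is measurable for the conditioning σ-algebra, so the conditional tail may be
integrated over events of the path. -/
theorem measure_inter_le_gap (hV : IsLimitChain P α β k V G) (n : ℕ) {s : Set (ℕ → ℝ)}
    (hs : MeasurableSet s) {y : ℝ} (hy : 0 ≤ y) :
    P ((fun ω => stoppedPath (fun m => V m ω) n) ⁻¹' s ∩ {ω | y ≤ G n ω})
      = ∫⁻ ω in (fun ω => stoppedPath (fun m => V m ω) n) ⁻¹' s,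
        ENNReal.ofReal (limitGapTail α k (V n ω) y) ∂P := by
  have hm : (⨆ m : Fin (n + 1), MeasurableSpace.comap (V m) inferInstance)
      ≤ (inferInstance : MeasurableSpace Ω) := iSup_le fun m => (hV.measurable m).comap_le
  have hB : MeasurableSet[⨆ m : Fin (n + 1), MeasurableSpace.comap (V m) inferInstance]
      ((fun ω => stoppedPath (fun m => V m ω) n) ⁻¹' s) := by
    refine @measurable_pi_lambda _ _ _ (_) _ _ (fun m => ?_) s hs
    refine measurable_iff_comap_le.2 ?_
    exact le_iSup_of_le (⟨min m n, by lia⟩ : Fin (n + 1)) le_rfl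
  have hA : MeasurableSet {ω | y ≤ G n ω} := hV.measurable_gap n measurableSet_Ici
  have hint : Integrable (({ω | y ≤ G n ω}).indicator fun _ => (1 : ℝ)) P :=
    (integrable_const _).indicator hA
  have h1 := setIntegral_condExp hm hint hB
  rw [setIntegral_congr_ae (hm _ hB) ((hV.condTail_gap n y hy).mono fun ω h _ => h),
    setIntegral_indicator hA, setIntegral_const, smul_eq_mul, mul_one] at h1
  have hint2 : Integrable (fun ω => limitGapTail α k (V n ω) y) P :=
    integrable_condExp.congr (hV.condTail_gap n y hy)
  rw [← ofReal_integral_eq_lintegral_ofReal hint2.integrableOn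
    (Eventually.of_forall fun ω => (Real.exp_pos _).le), h1, Measure.real,
    ENNReal.ofReal_toReal (measure_ne_top _ _)]

/-- The prescribed tail at `y = 0` equals `1`. -/
theorem ae_gap_nonneg (hV : IsLimitChain P α β k V G) (n : ℕ) : ∀ᵐ ω ∂P, 0 ≤ G n ω := by
  have h := hV.measure_inter_le_gap n MeasurableSet.univ le_rfl
  simp only [Set.preimage_univ, Set.univ_inter, limitGapTail, Measure.restrict_univ] at h
  norm_num at h
  exact (prob_compl_eq_zero_iff (hV.measurable_gap n measurableSet_Ici)).2 h

/-- The joint law of the limit chain up to time `n` and of the next gap, driven by an exponential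
variable. -/
theorem map_stoppedPath_gap (hV : IsLimitChain P α β (3 / 4) V G) (hα : 0 < α) (hβ : β < 1)
    (n : ℕ) :
    let X : Ω → ℕ → ℝ := fun ω => stoppedPath (fun m => V m ω) n
    P.map (fun ω => (X ω, G n ω)) = ((P.map X).prod (expMeasure 1)).map
      (fun q => (q.1, limitGap (α / 4) (max (q.1 n) 0 ^ (1 / 4 : ℝ)) q.2)) := by
  intro X
  have hX : Measurable X := measurable_stoppedPath hV.measurable n
  have hXG : Measurable fun ω => (X ω, G n ω) := hX.prodMk (hV.measurable_gap n)
  have hr : Measurable fun x : ℕ → ℝ => max (x n) 0 ^ (1 / 4 : ℝ) := by fun_prop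
  have hg : Measurable fun q : (ℕ → ℝ) × ℝ =>
      (q.1, limitGap (α / 4) (max (q.1 n) 0 ^ (1 / 4 : ℝ)) q.2) :=
    measurable_fst.prodMk (Measurable.limitGap (hr.comp measurable_fst) measurable_snd _)
  have := Measure.isProbabilityMeasure_map (μ := P) hXG.aemeasurable
  refine Measure.ext_prod_of_Ici fun s hs y => ?_
  have hrect : MeasurableSet (s ×ˢ Set.Ici y) := hs.prod measurableSet_Ici
  rw [Measure.map_apply hXG hrect, Measure.map_apply hg hrect, Measure.prod_apply (hg hrect)]
  have hsec : ∀ x : ℕ → ℝ, expMeasure 1 (Prod.mk x ⁻¹' ((fun q : (ℕ → ℝ) × ℝ =>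
      (q.1, limitGap (α / 4) (max (q.1 n) 0 ^ (1 / 4 : ℝ)) q.2)) ⁻¹' (s ×ˢ Set.Ici y)))
      = s.indicator (fun x => ENNReal.ofReal (Real.exp
        (-windowIntegral (α / 4) (max (x n) 0 ^ (1 / 4 : ℝ)) (max y 0)))) x := by
    intro x
    by_cases hx : x ∈ s
    · rw [Set.indicator_of_mem hx, ← expMeasure_setOf_le_limitGap (by positivity) (by positivity)]
      congr 1
      ext e
      simp [hx]
    · rw [Set.indicator_of_notMem hx]
      convert measure_empty (μ := expMeasure 1)
      ext e
      simp [hx]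
  have hmeas : Measurable fun x : ℕ → ℝ => ENNReal.ofReal (Real.exp
        (-windowIntegral (α / 4) (max (x n) 0 ^ (1 / 4 : ℝ)) (max y 0))) := by
    unfold windowIntegral
    fun_prop
  simp_rw [hsec]
  rw [lintegral_indicator hs, setLIntegral_map hs hmeas hX]
  -- The conditional tail is prescribed for `y ≥ 0` only; nonnegative gaps allow `max y 0` instead
  -- of `y`.
  have hleft : (fun ω => (X ω, G n ω)) ⁻¹' (s ×ˢ Set.Ici y)
      =ᵐ[P] (X ⁻¹' s ∩ {ω | max y 0 ≤ G n ω} : Set Ω) := by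
    filter_upwards [hV.ae_gap_nonneg n] with ω hω
    refine propext ?_
    change X ω ∈ s ∧ y ≤ G n ω ↔ X ω ∈ s ∧ max y 0 ≤ G n ω
    simp [hω]
  rw [measure_congr hleft, hV.measure_inter_le_gap n hs (le_max_right y 0)]
  refine lintegral_congr_ae (ae_restrict_of_ae ?_)
  filter_upwards [hV.ae_nonneg hβ n] with ω hω
  have hXn : X ω n = V n ω := stoppedPath_self _ _
  rw [limitGapTail_three_quarters hα hω, hXn, max_eq_left hω]

end IsLimitChain

/-! ### Scaling limit of one step. -/

theorem pow_four_mul_windowAfterLoss {b v : ℝ} (hb : 0 < b) (hv : 0 ≤ v) (α β g : ℝ) :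
    b ^ 4 * windowAfterLoss α β (3 / 4) (v / b ^ 4) g
      = (1 - β) * (v ^ (1 / 4 : ℝ) + α / 4 * (b * g)) ^ 4 := by
  have h : (v / b ^ 4) ^ (1 / 4 : ℝ) = v ^ (1 / 4 : ℝ) / b := by
    rw [Real.div_rpow hv (by positivity), ← Real.rpow_natCast b 4, ← Real.rpow_mul hb.le]
    norm_num
  rw [windowAfterLoss, windowAfter_three_quarters, h]
  field_simp

theorem mul_rpow_quarter {b : ℝ} (hb : 0 < b) (x : ℕ) :
    b * (x : ℝ) ^ (1 / 4 : ℝ) = (b ^ 4 * x) ^ (1 / 4 : ℝ) := by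
  rw [Real.mul_rpow (by positivity) (by positivity), ← Real.rpow_natCast b 4,
    ← Real.rpow_mul hb.le]
  norm_num

theorem tendsto_pow_four_mul_floor {ι : Type*} {l : Filter ι} {b v : ι → ℝ} {v' : ℝ}
    (hb : ∀ i, 0 < b i) (hb0 : Tendsto b l (𝓝 0)) (hv0 : ∀ i, 0 ≤ v i)
    (hv : Tendsto v l (𝓝 v')) :
    Tendsto (fun i => b i ^ 4 * (⌊v i / b i ^ 4⌋₊ : ℝ)) l (𝓝 v') := by
  have h1 : Tendsto (fun i => v i - b i ^ 4) l (𝓝 v') := by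
    simpa using hv.sub (hb0.pow 4)
  refine tendsto_of_tendsto_of_tendsto_of_le_of_le h1 hv (fun i => ?_) fun i => ?_
  · have hb4 : 0 < b i ^ 4 := pow_pos (hb i) 4
    have := mul_le_mul_of_nonneg_left (Nat.sub_one_lt_floor (v i / b i ^ 4)).le hb4.le
    rwa [mul_sub, mul_div_cancel₀ _ hb4.ne', mul_one] at this
  · have hb4 : 0 < b i ^ 4 := pow_pos (hb i) 4
    have := mul_le_mul_of_nonneg_left (Nat.floor_le (div_nonneg (hv0 i) hb4.le)) hb4.le
    rwa [mul_div_cancel₀ _ hb4.ne'] at this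

theorem tendsto_neg_log_one_sub_div :
    Tendsto (fun p : ℝ => -Real.log (1 - p) / p) (𝓝[≠] 0) (𝓝 1) := by
  have h : HasDerivAt (fun p : ℝ => -Real.log (1 - p)) 1 0 := by
    have := (((hasDerivAt_id (0 : ℝ)).const_sub 1).log (by simp)).fun_neg
    simpa using this
  refine h.tendsto_slope_zero.congr fun p => ?_
  simp [div_eq_inv_mul]

/-- The scaled window after a loss converges, continuously in the scaled window after the previous
loss. -/
theorem tendsto_scaled_windowAfterLoss {ι : Type*} {l : Filter ι} {α : ℝ} (hα : 0 < α) (β : ℝ)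
    {p v : ι → ℝ} {v' : ℝ} (hp0 : ∀ i, 0 < p i) (hp1 : ∀ i, p i < 1) (hp : Tendsto p l (𝓝 0))
    (hv0 : ∀ i, 0 ≤ v i) (hv : Tendsto v l (𝓝 v')) (hv'0 : 0 ≤ v') (e : ℝ) :
    Tendsto (fun i => p i ^ (4 / 5 : ℝ) * windowAfterLoss α β (3 / 4) (v i / p i ^ (4 / 5 : ℝ))
        (roundExceeding α (-Real.log (1 - p i)) ⌊v i / p i ^ (4 / 5 : ℝ)⌋₊ e)) l
      (𝓝 (windowAfterLoss α β (3 / 4) v' (limitGap (α / 4) (v' ^ (1 / 4 : ℝ)) e))) := by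
  -- The time scale: `b ^ 4` is the window scale, and `b ^ 5 = p` is asymptotic to the loss rate
  -- `-log (1 - p)`.
  let b : ι → ℝ := fun i => p i ^ (1 / 5 : ℝ)
  have hb : ∀ i, 0 < b i := fun i => Real.rpow_pos_of_pos (hp0 i) _
  have hpow : ∀ i (j : ℕ), b i ^ j = p i ^ ((j : ℝ) / 5) := fun i j => by
    rw [← Real.rpow_natCast, ← Real.rpow_mul (hp0 i).le]
    congr 1
    ring
  have hb4 : ∀ i, p i ^ (4 / 5 : ℝ) = b i ^ 4 := fun i => by rw [hpow]; norm_num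
  have hb5 : ∀ i, b i ^ 5 = p i := fun i => by rw [hpow]; norm_num
  have hb0 : Tendsto b l (𝓝 0) := by
    have := hp.rpow_const (p := (1 / 5 : ℝ)) (Or.inr (by norm_num))
    rwa [Real.zero_rpow (by norm_num)] at this
  have hc : ∀ i, 0 < -Real.log (1 - p i) := fun i =>
    neg_pos.2 (Real.log_neg (by linarith [hp1 i]) (by linarith [hp0 i]))
  have hcb : Tendsto (fun i => -Real.log (1 - p i) / b i ^ 5) l (𝓝 1) := by
    simp_rw [hb5]
    exact tendsto_neg_log_one_sub_div.comp
      (tendsto_nhdsWithin_iff.2 ⟨hp, Eventually.of_forall fun i => (hp0 i).ne'⟩)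
  have hx : Tendsto (fun i => b i * (⌊v i / b i ^ 4⌋₊ : ℝ) ^ (1 / 4 : ℝ)) l
      (𝓝 (v' ^ (1 / 4 : ℝ))) := by
    simp_rw [fun i => mul_rpow_quarter (hb i) ⌊v i / b i ^ 4⌋₊]
    exact (tendsto_pow_four_mul_floor hb hb0 hv0 hv).rpow_const (Or.inr (by norm_num))
  have hround := tendsto_mul_roundExceeding hα hb hb0 hc hcb (Real.rpow_nonneg hv'0 _) hx e
  simp_rw [hb4, fun i => pow_four_mul_windowAfterLoss (hb i) (hv0 i)]
  rw [windowAfterLoss, windowAfter_three_quarters]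
  exact (((hv.rpow_const (Or.inr (by norm_num))).add (hround.const_mul _)).pow 4).const_mul _

/-! ### Path recursions and induction over the losses. -/

theorem Nat.floor_max_zero_div {c : ℝ} (hc : 0 ≤ c) (y : ℝ) : ⌊max y 0 / c⌋₊ = ⌊y / c⌋₊ := by
  rcases le_total y 0 with h | h
  · rw [max_eq_right h, zero_div, Nat.floor_zero, Nat.floor_of_nonpos (div_nonpos_of_nonpos_of_nonneg h hc)]
  · rw [max_eq_left h]

theorem IsPacketLossModel.ae_window_nonneg {Ω : Type*} [MeasurableSpace Ω] {P : Measure Ω} {p : ℝ}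
    {V0 : Ω → ℝ} {lost : ℕ → ℕ → ℕ → Ω → Bool} (hV : IsPacketLossModel P p V0 lost) (α : ℝ)
    {β : ℝ} (hβ : β < 1) (n : ℕ) :
    ∀ᵐ ω ∂P, 0 ≤ lossEpochWindow α β (3 / 4) (fun m i j => lost m i j ω) (V0 ω) n := by
  cases n with
  | zero => exact hV.nonneg_init
  | succ n =>
    refine Eventually.of_forall fun ω => ?_
    rw [lossEpochWindow]
    exact mul_nonneg (by linarith) (windowAfter_three_quarters_nonneg _ _ _)

/-- The scaled path after one more loss, as a function of the scaled path and of an exponential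
variable. -/
theorem IsPacketLossModel.map_stoppedPath_succ {Ω : Type*} [MeasurableSpace Ω] {P : Measure Ω}
    [IsProbabilityMeasure P] {p : ℝ} {V0 : Ω → ℝ} {lost : ℕ → ℕ → ℕ → Ω → Bool}
    (hV : IsPacketLossModel P p V0 lost) (hp0 : 0 < p) (hp1 : p < 1) {α β c : ℝ} (hα : 0 < α)
    (hβ : β < 1) (hc : 0 < c) (n : ℕ) :
    let X : ℕ → Ω → ℕ → ℝ := fun n ω => stoppedPath
      (fun m => c * lossEpochWindow α β (3 / 4) (fun m i j => lost m i j ω) (V0 ω) m) n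
    let φ : (ℕ → ℝ) × ℝ → ℕ → ℝ := fun q => extendPath n q.1
      (c * windowAfterLoss α β (3 / 4) (max (q.1 n) 0 / c)
        (roundExceeding α (-Real.log (1 - p)) ⌊max (q.1 n) 0 / c⌋₊ q.2))
    Measurable φ ∧ P.map (X (n + 1)) = ((P.map (X n)).prod (expMeasure 1)).map φ := by
  intro X φ
  have hlam : 0 < -Real.log (1 - p) := neg_pos.2 (Real.log_neg (by linarith) (by linarith))
  have hcast : Measurable fun g : ℕ => (g : ℝ) := measurable_from_top
  let ψ : (ℕ → ℝ) × ℕ → ℕ → ℝ := fun q => extendPath n q.1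
    (c * windowAfterLoss α β (3 / 4) (max (q.1 n) 0 / c) q.2)
  have hψ : Measurable ψ := by
    have h0 : Measurable fun q : (ℕ → ℝ) × ℕ => max (q.1 n) 0 / c := by fun_prop
    have h1 := (Measurable.windowAfterLoss h0 (hcast.comp measurable_snd) α β (3 / 4)).const_mul c
    have h2 := (continuous_extendPath n).measurable.comp (measurable_fst.prodMk h1)
    exact h2
  have hdiv : Measurable fun x : ℕ → ℝ => x n / c := by fun_prop
  have hround : Measurable fun q : (ℕ → ℝ) × ℝ =>
      (q.1, roundExceeding α (-Real.log (1 - p)) ⌊q.1 n / c⌋₊ q.2) :=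
    measurable_fst.prodMk (Measurable.roundExceeding (hdiv.nat_floor.comp measurable_fst)
      measurable_snd hα hlam)
  have hφ : φ = fun q => ψ (q.1, roundExceeding α (-Real.log (1 - p)) ⌊q.1 n / c⌋₊ q.2) := by
    funext q
    simp only [φ, ψ, Nat.floor_max_zero_div hc.le]
  have hφm : Measurable φ := by
    rw [hφ]
    have := hψ.comp hround
    exact this
  refine ⟨hφm, ?_⟩
  have hX : ∀ n, Measurable (X n) := measurable_stoppedPath
    (fun m => (hV.measurable_window α β (3 / 4) m).const_mul c)
  have hG : Measurable fun ω => (X n ω, firstLossTime α (3 / 4) ⌊X n ω n / c⌋₊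
      (fun i j => lost n i j ω)) :=
    (hX n).prodMk (Measurable.firstLossTime (hdiv.nat_floor.comp (hX n)) (hV.measurable_epoch n) α _)
  have h := congrArg (Measure.map ψ) (hV.map_stoppedPath_firstLossTime hp0 hp1 hα β c n)
  rw [Measure.map_map hψ hG, Measure.map_map hψ hround, Function.comp_def, Function.comp_def] at h
  rw [hφ, ← h]
  refine Measure.map_congr ?_
  filter_upwards [hV.ae_window_nonneg α hβ n] with ω hω
  have hXn : X n ω n
      = c * lossEpochWindow α β (3 / 4) (fun m i j => lost m i j ω) (V0 ω) n := stoppedPath_self _ _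
  simp only [ψ]
  rw [hXn, max_eq_left (mul_nonneg hc.le hω), mul_div_cancel_left₀ _ hc.ne']
  exact stoppedPath_succ _ n

theorem IsLimitChain.map_stoppedPath_succ {Ω : Type*} [MeasurableSpace Ω] {P : Measure Ω}
    [IsProbabilityMeasure P] {α β : ℝ} {V G : ℕ → Ω → ℝ} (hV : IsLimitChain P α β (3 / 4) V G)
    (hα : 0 < α) (hβ : β < 1) (n : ℕ) :
    let X : ℕ → Ω → ℕ → ℝ := fun n ω => stoppedPath (fun m => V m ω) n
    let φ : (ℕ → ℝ) × ℝ → ℕ → ℝ := fun q => extendPath n q.1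
      (windowAfterLoss α β (3 / 4) (max (q.1 n) 0)
        (limitGap (α / 4) (max (q.1 n) 0 ^ (1 / 4 : ℝ)) q.2))
    Measurable φ ∧ P.map (X (n + 1)) = ((P.map (X n)).prod (expMeasure 1)).map φ := by
  intro X φ
  let ψ : (ℕ → ℝ) × ℝ → ℕ → ℝ := fun q => extendPath n q.1
    (windowAfterLoss α β (3 / 4) (max (q.1 n) 0) q.2)
  have hψ : Measurable ψ := by
    have h0 : Measurable fun q : (ℕ → ℝ) × ℝ => max (q.1 n) 0 := by fun_prop
    have h1 := Measurable.windowAfterLoss h0 measurable_snd α β (3 / 4)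
    have h2 := (continuous_extendPath n).measurable.comp (measurable_fst.prodMk h1)
    exact h2
  have hr : Measurable fun x : ℕ → ℝ => max (x n) 0 ^ (1 / 4 : ℝ) := by fun_prop
  have hgap : Measurable fun q : (ℕ → ℝ) × ℝ =>
      (q.1, limitGap (α / 4) (max (q.1 n) 0 ^ (1 / 4 : ℝ)) q.2) :=
    measurable_fst.prodMk (Measurable.limitGap (hr.comp measurable_fst) measurable_snd _)
  refine ⟨hψ.comp hgap, ?_⟩
  have hX : ∀ n, Measurable (X n) := measurable_stoppedPath hV.measurable
  have h := congrArg (Measure.map ψ) (hV.map_stoppedPath_gap hα hβ n)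
  rw [Measure.map_map hψ ((hX n).prodMk (hV.measurable_gap n)), Measure.map_map hψ hgap,
    Function.comp_def, Function.comp_def] at h
  refine Eq.trans ?_ h
  refine Measure.map_congr ?_
  filter_upwards [hV.ae_nonneg hβ n] with ω hω
  have hXn : X n ω n = V n ω := stoppedPath_self _ _
  have hsucc : X (n + 1) ω = extendPath n (X n ω) (V (n + 1) ω) := stoppedPath_succ _ n
  rw [hsucc, hV.succ]
  simp only [ψ]
  rw [hXn, max_eq_left hω]

/-- Convergence in distribution of the scaled window paths up to the `n`-th loss. -/
theorem tendstoInDistribution_stoppedPath {α β : ℝ} (hα : 0 < α) (hβ : β < 1)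
    {Ω : Set.Ioo (0 : ℝ) 1 → Type*} [∀ p, MeasurableSpace (Ω p)]
    {P : ∀ p, Measure (Ω p)} [∀ p, IsProbabilityMeasure (P p)]
    {V0 : ∀ p, Ω p → ℝ} {lost : ∀ p, ℕ → ℕ → ℕ → Ω p → Bool}
    (hV : ∀ p, IsPacketLossModel (P p) (p : ℝ) (V0 p) (lost p))
    {Ω' : Type*} [MeasurableSpace Ω'] {P' : Measure Ω'} [IsProbabilityMeasure P']
    {Vbar Gbar : ℕ → Ω' → ℝ} (hVbar : IsLimitChain P' α β (3 / 4) Vbar Gbar)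
    (h0 : TendstoInDistribution
      (fun (p : Set.Ioo (0 : ℝ) 1) ω => (p : ℝ) ^ (4 / 5 : ℝ) * V0 p ω)
      (Filter.comap (Subtype.val : Set.Ioo (0 : ℝ) 1 → ℝ) (𝓝 0)) (Vbar 0) P P') (n : ℕ) :
    TendstoInDistribution (fun (p : Set.Ioo (0 : ℝ) 1) ω => stoppedPath (fun m =>
        (p : ℝ) ^ (4 / 5 : ℝ) *
          lossEpochWindow α β (3 / 4) (fun m i j => lost p m i j ω) (V0 p ω) m) n)
      (Filter.comap (Subtype.val : Set.Ioo (0 : ℝ) 1 → ℝ) (𝓝 0))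
      (fun ω => stoppedPath (fun m => Vbar m ω) n) P P' := by
  have hX : ∀ n (p : Set.Ioo (0 : ℝ) 1), Measurable fun ω => stoppedPath (fun m =>
      (p : ℝ) ^ (4 / 5 : ℝ) *
        lossEpochWindow α β (3 / 4) (fun m i j => lost p m i j ω) (V0 p ω) m) n := fun n p =>
    measurable_stoppedPath
      (fun m => ((hV p).measurable_window α β (3 / 4) m).const_mul ((p : ℝ) ^ (4 / 5 : ℝ))) n
  induction n with
  | zero =>
    have hconst : Continuous fun (v : ℝ) (_ : ℕ) => v := by fun_prop
    have h := h0.continuous_comp hconst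
    have hzero : ∀ V : ℕ → ℝ, stoppedPath V 0 = fun _ => V 0 := fun V => by
      ext m
      simp [stoppedPath]
    simpa only [hzero, lossEpochWindow, Function.comp_def] using h
  | succ n ih =>
    have hstep := fun p : Set.Ioo (0 : ℝ) 1 => (hV p).map_stoppedPath_succ p.2.1 p.2.2 hα hβ
      (Real.rpow_pos_of_pos p.2.1 (4 / 5)) n
    have hstep' := hVbar.map_stoppedPath_succ hα hβ n
    refine ih.of_map_prod (expMeasure 1) (fun p => (hX (n + 1) p).aemeasurable)
      (measurable_stoppedPath hVbar.measurable (n + 1)).aemeasurable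
      (fun p => (hstep p).1) hstep'.1 (fun p => (hstep p).2) hstep'.2 fun x => ?_
    refine Eventually.of_forall fun e => ?_
    have hsnd : Tendsto (fun q : Set.Ioo (0 : ℝ) 1 × (ℕ → ℝ) => q.2)
        (Filter.comap Subtype.val (𝓝 0) ×ˢ 𝓝 x) (𝓝 x) := tendsto_snd
    have hfst : Tendsto (fun q : Set.Ioo (0 : ℝ) 1 × (ℕ → ℝ) => (q.1 : ℝ))
        (Filter.comap Subtype.val (𝓝 0) ×ˢ 𝓝 x) (𝓝 0) := tendsto_comap.comp tendsto_fst
    -- Weak convergence on `ℕ → ℝ` also involves paths with negative entries, where the maps must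
    -- still converge; the truncation ensures this and changes nothing almost surely.
    have hv : Tendsto (fun q : Set.Ioo (0 : ℝ) 1 × (ℕ → ℝ) => max (q.2 n) 0)
        (Filter.comap Subtype.val (𝓝 0) ×ˢ 𝓝 x) (𝓝 (max (x n) 0)) :=
      ((tendsto_pi_nhds.1 hsnd n).max tendsto_const_nhds)
    have hlim := tendsto_scaled_windowAfterLoss hα β (fun q => q.1.2.1) (fun q => q.1.2.2) hfst
      (fun q => le_max_right _ _) hv (le_max_right _ _) e
    exact ((continuous_extendPath n).tendsto _).comp (hsnd.prodMk_nhds hlim)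

theorem mainTheorem9 (α β k : ℝ) (hα : 0 < α) (hβ0 : 0 < β) (hβ1 : β < 1) (hk : k = 3 / 4)
    -- for each loss probability `p ∈ (0, 1)`, an initial window and packet losses
    {Ω : Set.Ioo (0 : ℝ) 1 → Type*} [∀ p, MeasurableSpace (Ω p)]
    (P : ∀ p, Measure (Ω p)) [∀ p, IsProbabilityMeasure (P p)]
    (V0 : ∀ p, Ω p → ℝ) (lost : ∀ p, ℕ → ℕ → ℕ → Ω p → Bool)
    (hV : ∀ p, IsPacketLossModel (P p) (p : ℝ) (V0 p) (lost p))
    -- the limit chain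
    {Ω' : Type*} [MeasurableSpace Ω'] (P' : Measure Ω') [IsProbabilityMeasure P']
    (Vbar Gbar : ℕ → Ω' → ℝ) (hVbar : IsLimitChain P' α β k Vbar Gbar)
    -- convergence in distribution of the scaled initial windows as `p → 0`
    (h0 : TendstoInDistribution
      (fun (p : Set.Ioo (0 : ℝ) 1) ω => (p : ℝ) ^ (1 / (2 - k)) * V0 p ω)
      (Filter.comap (Subtype.val : Set.Ioo (0 : ℝ) 1 → ℝ) (𝓝 0)) (Vbar 0) P P') :
    -- convergence of the finite-dimensional distributions of the scaled chains
    ∀ I : Finset ℕ, TendstoInDistribution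
      (fun (p : Set.Ioo (0 : ℝ) 1) ω (n : I) => (p : ℝ) ^ (1 / (2 - k)) *
        lossEpochWindow α β k (fun m i j => lost p m i j ω) (V0 p ω) n)
      (Filter.comap (Subtype.val : Set.Ioo (0 : ℝ) 1 → ℝ) (𝓝 0))
      (fun ω (n : I) => Vbar n ω) P P' := by
  intro I
  subst hk
  rw [show (1 : ℝ) / (2 - 3 / 4) = 4 / 5 by norm_num] at h0 ⊢
  have hrestrict : Continuous fun (x : ℕ → ℝ) (n : I) => x n := by fun_prop
  have h := (tendstoInDistribution_stoppedPath hα hβ1 hV hVbar h0 (I.sup id)).continuous_comp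
    hrestrict
  -- A path frozen at the largest element of `I` still shows all the windows indexed by `I`.
  have hmin : ∀ n : I, min (n : ℕ) (I.sup id) = n := fun n =>
    min_eq_left (Finset.le_sup (f := id) n.2)
  simpa only [Function.comp_def, stoppedPath, hmin] using h
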